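/- **Setting.** Strings are binary. For a function $g:\{0,1\}^*\to\{0,1\}^*$ let $\Sigma_0^P(g)=\mathsf P^g$ (polynomial time with a function oracle for $g$) and $\Sigma_{k+1}^P(g)=\mathsf{NP}^{\Sigma_k^P(g)}$; for a class $\mathsf C$ of string functions let $(\Sigma_k^P)^{\mathsf C}=\bigcup_{g\in\mathsf C}\Sigma_k^P(g)$. A family of real functions $F_j:D_j\to\mathbb R$, $D_j\subseteq\mathbb R^{k_j}$, named by strings $c_j$, is in the Type 2 complexity class $\mathsf C$ if there are a polynomial $m$ and a $\theta\in\mathsf C$ with polynomially long values such that for all $j$, all $i\in\mathbb N$, all $x\in D_j$ and all dyadic $d$ with $|d_l-x_l|\le 2^{-m(|c_j|+i)}$ for every coordinate $l$, the value $\theta(c_j,d,1^i)$ is (the code of) a dyadic rational $r$ with $|r-F_j(x)|<2^{-i}$. **Systems.** Consider a system $\dot x=f(x)$ on $\mathbb R^n$ with $f$ Lipschitz, and write $\Phi(t,x_0)=x_0+\int_0^t f(x(s))\,ds$, where $x(\cdot)$ is the solution with $x(0)=x_0$. Let $X=\prod_i[a_i,b_i]$ be a compact box, $T,T'>0$, and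 let $0\le \delta_1\le \varepsilon_1\le e$, $0\le\delta_1'\le d$, $0\le\varepsilon_1'\le e'$, $0\le\delta_1''\le d'$ be reals with $e,d,e',d'>0$. The bounded formula $\mathsf{A\_stable}$ is the conjunction of $$\forall \varepsilon\in[\varepsilon_1,e]\ \exists\delta\in[\delta_1,\varepsilon]\ \forall t\in[0,T]\ \forall x_0\in X\ \forall x_t\in X\ \big((\|x_0\|<\delta\wedge x_t=\Phi(t,x_0))\to\|x_t\|<\varepsilon\big)$$ and $$\exists\delta'\in[\delta_1',d]\ \forall t\in[0,T']\ \forall x_0\in X\ \forall x_t\in X\ \big((\|x_0\|<\delta'\wedge x_t=\Phi(t,x_0))\to \lim_{s\to T'}\|\Phi(s,x_0)\|=0\big),$$ where $\lim_{s\to T'}g(s)=0$ stands for the bounded formula $\forall\varepsilon'\in[\varepsilon_1',e']\ \exists\delta''\in[\delta_1'',d']\ \forall s\in[T'-\delta'',T'+\delta'']\ |g(s)|<\varepsilon'$. Implications are expanded so that the formula is built by $\wedge,\vee$ and bounded quantifiers from atoms $\tau>0$ and $\tau\ge0$; the equation $x_t=\Phi(t,x_0)$ is the atom $-\|x_t-\Phi(t,x_0)\|\ge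 0$, and $\neg(\tau>0)$, $\neg(\tau\ge 0)$ are $-\tau\ge0$, $-\tau>0$. For $\delta>0$, a $\delta$-perturbation of a formula replaces each atom $\tau>0$ (resp. $\tau\ge0$) by $\tau>c$ (resp. $\tau\ge c$) with a constant $|c|\le\delta$ depending on the atom; quantifier bounds are not changed. **Problem.** Let $S$ be a set of strings, each $w\in S$ being the code of a system with bounds as above. The bounded asymptotic $\delta$-stability problem for $S$ asks, on input $(w,1^n,\delta)$ with $w\in S$, $n$ the dimension of the system coded by $w$, and $\delta\in\mathbb Q^+$ in binary, for one of the answers *stable* ($\mathsf{A\_stable}$ of the system coded by $w$ is true) or *$\delta$-unstable* (some $\delta$-perturbation of this formula is false); if both are correct, either may be given. **Theorem.** Let $\mathsf C$ be a class of string functions. Suppose that the terms of the representations of the systems coded by $w\in S$ are in the Type 2 complexity class $\mathsf C$, that is, the family consisting, for all $w\in S$, of the coordinate functions $\Phi_i$ of the flow on $([0,T]\cup[0,T']\cup[T'-d',T'+d'])\times X$ and of the constants (0-ary functions) $a_i,b_i,T,T',\varepsilon_1,e,\delta_1,\delta_1',d,\varepsilon_1',e',\delta_1'',d'$, each named by $w$,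 $1^n$ and a tag for the term. Then bounded asymptotic $\delta$-stability is in $(\Sigma_4^P)^{\mathsf C}$: there is a language in $(\Sigma_4^P)^{\mathsf C}$ such that answering *stable* for its members and *$\delta$-unstable* for its non-members is correct for all inputs. -/

import Mathlib

noncomputable section

namespace DeltaStab

/-! ### Strings -/

/-- A finite list of binary strings as one binary string: each bit `b` becomes `1b`, and each
string is terminated by `0`. -/
def encodeList (l : List (List Bool)) : List Bool :=
  l.flatMap fun s => (s.flatMap fun b => [true, b]) ++ [false]

/-- The number `k` in unary. -/
def unary (k : ℕ) : List Bool := List.replicate k true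

/-- The dyadic rational `m / 2 ^ k` represented by the pair `(m, k)`. -/
def dyadicVal (r : ℤ × ℕ) : ℝ := (r.1 : ℝ) / 2 ^ r.2

/-- The string for the dyadic `m / 2 ^ k`: sign, binary digits of `|m|`, and `k` in unary (so the
length is about the number of digits before and after the binary point). -/
def encodeDyadic (r : ℤ × ℕ) : List Bool :=
  encodeList [[decide (r.1 < 0)], Nat.bits r.1.natAbs, unary r.2]

/-- The string for a positive rational: numerator and denominator in binary. -/
def encodeRat (q : ℚ) : List Bool :=
  encodeList [Nat.bits q.num.natAbs, Nat.bits q.den]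

/-! ### Oracle machines and the relativized polynomial hierarchy -/

/-- A function-oracle Turing machine: a finite multi-stack machine (Mathlib's `TM2`) over the
binary alphabet, with an input stack, a query stack, and two distinguished control labels
`ask`, `answer`. -/
structure OracleTM where
  K : Type
  [decEqK : DecidableEq K]
  [finK : Finite K]
  Λ : Type
  [finΛ : Finite Λ]
  σ : Type
  [finσ : Finite σ]
  input : K
  query : K
  main : Λ
  ask : Λ
  answer : Λ
  start : σ
  accept : σ → Bool
  prog : Λ → Turing.TM2.Stmt (fun _ : K => Bool) Λ σ

attribute [instance] OracleTM.decEqK OracleTM.finK OracleTM.finΛ OracleTM.finσ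

namespace OracleTM

abbrev Cfg (M : OracleTM) : Type := Turing.TM2.Cfg (fun _ : M.K => Bool) M.Λ M.σ

def initCfg (M : OracleTM) (x : List Bool) : M.Cfg where
  l := some M.main
  var := M.start
  stk := Function.update (fun _ => []) M.input x

open Classical in
/-- One step with oracle `g`. At the label `ask` the string `s` on the query stack is replaced by
`g s` and control passes to `answer`; at any other label the program of that label is executed.
A halted configuration (no label) does not change. -/
def step (M : OracleTM) (g : List Bool → List Bool) (c : M.Cfg) : M.Cfg :=
  match c.l with
  | none => c
  | some l =>
    if l = M.ask then
      { c with
        l := some M.answer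
        stk := Function.update c.stk M.query (g (c.stk M.query)) }
    else Turing.TM2.stepAux (M.prog l) c.var c.stk

/-- With oracle `g`, the machine halts on `x` within `t` steps and accepts iff `x ∈ L`. -/
def DecidesWithin (M : OracleTM) (g : List Bool → List Bool) (L : Set (List Bool))
    (x : List Bool) (t : ℕ) : Prop :=
  ((M.step g)^[t] (M.initCfg x)).l = none ∧
    (M.accept ((M.step g)^[t] (M.initCfg x)).var = true ↔ x ∈ L)

end OracleTM

/-- `P^g`. -/
def PTime (g : List Bool → List Bool) : Set (Set (List Bool)) :=
  {L | ∃ (M : OracleTM) (p : Polynomial ℕ), ∀ x, M.DecidesWithin g L x (p.eval x.length)}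

/-- `NP^g`: membership has polynomially short certificates checked in `P^g`. -/
def NPTime (g : List Bool → List Bool) : Set (Set (List Bool)) :=
  {L | ∃ V ∈ PTime g, ∃ p : Polynomial ℕ, ∀ x,
    x ∈ L ↔ ∃ y : List Bool, y.length ≤ p.eval x.length ∧ encodeList [x, y] ∈ V}

open Classical in
/-- A set oracle as a function oracle. -/
def charFn (B : Set (List Bool)) (x : List Bool) : List Bool := [decide (x ∈ B)]

/-- `Σ₀^P(g) = P^g` and `Σ_{k+1}^P(g) = NP^{Σ_k^P(g)}`. -/
def SigmaP (g : List Bool → List Bool) : ℕ → Set (Set (List Bool))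
  | 0 => PTime g
  | k + 1 => {L | ∃ B ∈ SigmaP g k, L ∈ NPTime (charFn B)}

/-- `(Σ_k^P)^C`, for a class `C` of string functions used as oracles. -/
def SigmaPClass (C : Set (List Bool → List Bool)) (k : ℕ) : Set (Set (List Bool)) :=
  {L | ∃ g ∈ C, L ∈ SigmaP g k}

/-! ### Type 2 complexity of real functions -/

/-- A real function `f :⊆ ℝ^arity → ℝ` with domain `dom`. -/
structure RealFn where
  arity : ℕ
  dom : Set (Fin arity → ℝ)
  toFun : (Fin arity → ℝ) → ℝ

/-- The real functions `F j`, with names `code j`, are in the Type 2 complexity class given by the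
class `C` of string functions: there are a polynomial modulus `m` and a function `θ` in `C`, with
polynomially long values, such that from any dyadic `2^{-m}`-approximation `d` of any point `x` of
the domain, `θ` produces a dyadic `2^{-i}`-approximation of `F j x`. For a single function (`j`
ranging over one element) `code j` is a constant, and this is the usual representation `(m, θ)`;
for `C` the polynomial time (space) functions one gets polynomial time (space) computable real
functions. For a family the representation is uniform in the code. -/
def InType2Class (C : Set (List Bool → List Bool)) {ι : Type} (code : ι → List Bool)
    (F : ι → RealFn) : Prop :=
  ∃ θ ∈ C, ∃ m p : Polynomial ℕ, (∀ x, (θ x).length ≤ p.eval x.length) ∧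
    ∀ (j : ι) (i : ℕ), ∀ x ∈ (F j).dom, ∀ d : Fin (F j).arity → ℤ × ℕ,
      (∀ l, |dyadicVal (d l) - x l| ≤ (2 : ℝ)⁻¹ ^ (m.eval ((code j).length + i))) →
      ∃ r : ℤ × ℕ,
        θ (encodeList [code j, encodeList (List.ofFn fun l => encodeDyadic (d l)), unary i])
          = encodeDyadic r ∧
        |dyadicVal r - (F j).toFun x| < (2 : ℝ)⁻¹ ^ i

/-! ### Bounded first-order formulas over the reals and their perturbations -/

/-- A term with variables in `V`, identified with the real function of the assignment that it
denotes. -/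
abbrev Term (V : Type) : Type := (V → ℝ) → ℝ

/-- Formulas with atoms `t > 0`, `t ≥ 0` and bounded quantifiers `∀^{[u,v]} x`, `∃^{[u,v]} x`. -/
inductive Formula (V : Type) : Type
  | gt (t : Term V) : Formula V
  | ge (t : Term V) : Formula V
  | and (φ ψ : Formula V) : Formula V
  | or (φ ψ : Formula V) : Formula V
  | all (x : V) (u v : Term V) (φ : Formula V) : Formula V
  | ex (x : V) (u v : Term V) (φ : Formula V) : Formula V

namespace Formula

variable {V : Type}

def Holds [DecidableEq V] : Formula V → (V → ℝ) → Prop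
  | gt t, a => t a > 0
  | ge t, a => t a ≥ 0
  | and φ ψ, a => φ.Holds a ∧ ψ.Holds a
  | or φ ψ, a => φ.Holds a ∨ ψ.Holds a
  | all x u v φ, a => ∀ r : ℝ, u a ≤ r ∧ r ≤ v a → φ.Holds (Function.update a x r)
  | ex x u v φ, a => ∃ r : ℝ, (u a ≤ r ∧ r ≤ v a) ∧ φ.Holds (Function.update a x r)

/-- Truth of a sentence (the assignment is irrelevant if no variable is free). -/
def IsTrue [DecidableEq V] (φ : Formula V) : Prop := φ.Holds fun _ => 0

/-- Negation, as an operation on formulas. -/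
def neg : Formula V → Formula V
  | gt t => ge fun a => -t a
  | ge t => gt fun a => -t a
  | and φ ψ => or φ.neg ψ.neg
  | or φ ψ => and φ.neg ψ.neg
  | all x u v φ => ex x u v φ.neg
  | ex x u v φ => all x u v φ.neg

def imp (φ ψ : Formula V) : Formula V := or φ.neg ψ

/-- `s < t`, i.e. `t - s > 0`. -/
def lt (s t : Term V) : Formula V := gt fun a => t a - s a

/-- `∀^X` for a box `X`: one bounded quantifier for each coordinate. -/
def allBox {n : ℕ} (x : Fin n → V) (lo hi : Fin n → ℝ) (φ : Formula V) : Formula V :=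
  (List.finRange n).foldr (fun i ψ => all (x i) (fun _ => lo i) (fun _ => hi i) ψ) φ

/-- `IsPerturbation δ φ φ'`: `φ'` arises from `φ` by replacing each atom `t > 0` by `t > c` and
each atom `t ≥ 0` by `t ≥ c`, with a constant `c ∈ [-δ, δ]` for each occurrence of an atom. The
bounds of the quantifiers are kept. -/
inductive IsPerturbation (δ : ℝ) : Formula V → Formula V → Prop
  | gt (t : Term V) (c : ℝ) (hc : |c| ≤ δ) : IsPerturbation δ (gt t) (gt fun a => t a - c)
  | ge (t : Term V) (c : ℝ) (hc : |c| ≤ δ) : IsPerturbation δ (ge t) (ge fun a => t a - c)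
  | and {φ φ' ψ ψ' : Formula V} (h₁ : IsPerturbation δ φ φ') (h₂ : IsPerturbation δ ψ ψ') :
      IsPerturbation δ (and φ ψ) (and φ' ψ')
  | or {φ φ' ψ ψ' : Formula V} (h₁ : IsPerturbation δ φ φ') (h₂ : IsPerturbation δ ψ ψ') :
      IsPerturbation δ (or φ ψ) (or φ' ψ')
  | all (x : V) (u v : Term V) {φ φ' : Formula V} (h : IsPerturbation δ φ φ') :
      IsPerturbation δ (all x u v φ) (all x u v φ')
  | ex (x : V) (u v : Term V) {φ φ' : Formula V} (h : IsPerturbation δ φ φ') :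
      IsPerturbation δ (ex x u v φ) (ex x u v φ')

end Formula

/-! ### Continuous systems and bounded asymptotic stability -/

/-- The solution of `x' = f(x)`, `x(0) = x₀` (in integral form); it exists on all of `ℝ` and is
unique when `f` is Lipschitz. -/
def trajectory {n : ℕ} (f : EuclideanSpace ℝ (Fin n) → EuclideanSpace ℝ (Fin n))
    (x₀ : EuclideanSpace ℝ (Fin n)) : ℝ → EuclideanSpace ℝ (Fin n) :=
  Classical.epsilon fun x => Continuous x ∧ ∀ t : ℝ, x t = x₀ + ∫ s in (0 : ℝ)..t, f (x s)

/-- The right-hand side `∫_0^t f(x(s)) ds + x₀` of the flow equation. -/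
def flowMap {n : ℕ} (f : EuclideanSpace ℝ (Fin n) → EuclideanSpace ℝ (Fin n))
    (t : ℝ) (x₀ : EuclideanSpace ℝ (Fin n)) : EuclideanSpace ℝ (Fin n) :=
  (∫ s in (0 : ℝ)..t, f (trajectory f x₀ s)) + x₀

/-- The real constants that bound the quantifiers (apart from the box `X`). -/
inductive Bound : Type
  | εlo | εhi | δlo | T | T' | δ'lo | δ'hi | ε'lo | ε'hi | δ''lo | δ''hi

/-- An `n`-dimensional system `x' = f(x)` with `f` Lipschitz, together with quantifier bounds:
a box `X = ∏ [lo i, hi i]`, time bounds `T`, `T'`, and nonempty closed intervals for the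
quantified `ε`, `δ`, `δ'` and for the `ε'`, `δ''` of the limit. Lower bounds equal to `0` are
allowed. -/
structure BoundedSystem where
  n : ℕ
  f : EuclideanSpace ℝ (Fin n) → EuclideanSpace ℝ (Fin n)
  lipschitz : ∃ k : NNReal, LipschitzWith k f
  lo : Fin n → ℝ
  hi : Fin n → ℝ
  lo_le_hi : ∀ i, lo i ≤ hi i
  b : Bound → ℝ
  T_pos : 0 < b .T
  T'_pos : 0 < b .T'
  δ_nonneg : 0 ≤ b .δlo
  δ_le : b .δlo ≤ b .εlo
  ε_le : b .εlo ≤ b .εhi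
  ε_pos : 0 < b .εhi
  δ'_nonneg : 0 ≤ b .δ'lo
  δ'_le : b .δ'lo ≤ b .δ'hi
  δ'_pos : 0 < b .δ'hi
  ε'_nonneg : 0 ≤ b .ε'lo
  ε'_le : b .ε'lo ≤ b .ε'hi
  ε'_pos : 0 < b .ε'hi
  δ''_nonneg : 0 ≤ b .δ''lo
  δ''_le : b .δ''lo ≤ b .δ''hi
  δ''_pos : 0 < b .δ''hi

/-- The variables of the stability formula. -/
inductive Var (n : ℕ) : Type
  | ε | δ | t | δ' | ε' | δ'' | s
  | x₀ (i : Fin n)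
  | xₜ (i : Fin n)
  deriving DecidableEq

namespace BoundedSystem

variable (B : BoundedSystem)

/-- The vector of values of the variables `x i`. -/
def vec {n : ℕ} (x : Fin n → Var n) (a : Var n → ℝ) : EuclideanSpace ℝ (Fin n) :=
  WithLp.toLp 2 fun i => a (x i)

/-- A quantifier bound, as a 0-ary term. -/
def const (k : Bound) : Term (Var B.n) := fun _ => B.b k

/-- The formula `x_t = ∫_0^t f(x(s)) ds + x₀`, as the atom `-‖x_t - (∫_0^t f(x(s)) ds + x₀)‖ ≥ 0`
(whose `δ`-weakening says that the norm is at most `δ`). -/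
def flow : Formula (Var B.n) :=
  .ge fun a => -‖vec .xₜ a - flowMap B.f (a .t) (vec .x₀ a)‖

/-- The bounded formula for `lim_{s → T'} g(s) = c`: for all `ε'` there is `δ''` such that
`|g(s) - c| < ε'` for all `s ∈ [T' - δ'', T' + δ'']`. -/
def limAtT' (g : Term (Var B.n)) (c : ℝ) : Formula (Var B.n) :=
  .all .ε' (B.const .ε'lo) (B.const .ε'hi) <|
  .ex .δ'' (B.const .δ''lo) (B.const .δ''hi) <|
  .all .s (fun a => B.b .T' - a .δ'') (fun a => B.b .T' + a .δ'') <|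
  .lt (fun a => |g a - c|) (fun a => a .ε')

/-- The bounded form of Lyapunov stability. -/
def lStable : Formula (Var B.n) :=
  .all .ε (B.const .εlo) (B.const .εhi) <|
  .ex .δ (B.const .δlo) (fun a => a .ε) <|
  .all .t (fun _ => 0) (B.const .T) <|
  .allBox .x₀ B.lo B.hi <| .allBox .xₜ B.lo B.hi <|
  .imp (.and (.lt (fun a => ‖vec .x₀ a‖) (fun a => a .δ)) B.flow)
    (.lt (fun a => ‖vec .xₜ a‖) (fun a => a .ε))

/-- The bounded form of convergence to the origin, with `x_s = ∫_0^s f(x(r)) dr + x₀` in the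
limit. -/
def attractive : Formula (Var B.n) :=
  .ex .δ' (B.const .δ'lo) (B.const .δ'hi) <|
  .all .t (fun _ => 0) (B.const .T') <|
  .allBox .x₀ B.lo B.hi <| .allBox .xₜ B.lo B.hi <|
  .imp (.and (.lt (fun a => ‖vec .x₀ a‖) (fun a => a .δ')) B.flow)
    (B.limAtT' (fun a => ‖flowMap B.f (a .s) (vec .x₀ a)‖) 0)

/-- The bounded form of asymptotic stability. -/
def aStable : Formula (Var B.n) := .and B.lStable B.attractive

/-- The names of the terms of the representation: coordinates of the flow, endpoints of the box,
and the other quantifier bounds. -/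
inductive TermName (n : ℕ) : Type
  | flow (i : Fin n)
  | lo (i : Fin n)
  | hi (i : Fin n)
  | bound (k : Bound)

/-- A string for each term name. -/
def TermName.code {n : ℕ} : TermName n → List Bool
  | .flow i => encodeList [unary 0, unary i]
  | .lo i => encodeList [unary 1, unary i]
  | .hi i => encodeList [unary 2, unary i]
  | .bound k => encodeList [unary 3, unary k.ctorIdx]

/-- The times at which the flow occurs in the stability formula. -/
def times : Set ℝ :=
  Set.Icc 0 (B.b .T) ∪ Set.Icc 0 (B.b .T') ∪
    Set.Icc (B.b .T' - B.b .δ''hi) (B.b .T' + B.b .δ''hi)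

/-- The real function denoted by a term: for a flow coordinate, the function
`(t, x₀) ↦ (∫_0^t f(x(s)) ds + x₀)_i` on `times × X`; otherwise a constant (0-ary function). -/
def term : TermName B.n → RealFn
  | .flow i =>
    { arity := B.n + 1
      dom := {z | z 0 ∈ B.times ∧ ∀ j : Fin B.n, z j.succ ∈ Set.Icc (B.lo j) (B.hi j)}
      toFun := fun z => flowMap B.f (z 0) (WithLp.toLp 2 fun j => z j.succ) i }
  | .lo i => { arity := 0, dom := Set.univ, toFun := fun _ => B.lo i }
  | .hi i => { arity := 0, dom := Set.univ, toFun := fun _ => B.hi i }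
  | .bound k => { arity := 0, dom := Set.univ, toFun := fun _ => B.b k }

end BoundedSystem

/-- All terms in the representations of the systems `sys w`, `w ∈ S`, are in the Type 2 complexity
class `C`. -/
def TermsInClass (C : Set (List Bool → List Bool)) (S : Set (List Bool))
    (sys : S → BoundedSystem) : Prop :=
  InType2Class C (ι := (w : S) × BoundedSystem.TermName (sys w).n)
    (fun j => encodeList [j.1.1, unary (sys j.1).n, j.2.code])
    (fun j => (sys j.1).term j.2)

/-- The input string of the stability problem for the system with code `w` and the rational `δ`. -/
def instanceCode (S : Set (List Bool)) (sys : S → BoundedSystem) (w : S) (δ : ℚ) : List Bool :=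
  encodeList [w.1, unary (sys w).n, encodeRat δ]

/-- `L` answers the bounded asymptotic `δ`-stability problem for the systems `sys w`, `w ∈ S`:
acceptance is the answer "stable", which is correct only if the stability formula is true;
rejection is the answer "`δ`-unstable", which is correct only if some `δ`-perturbation of the
formula is false. -/
def SolvesStability (S : Set (List Bool)) (sys : S → BoundedSystem) (L : Set (List Bool)) : Prop :=
  ∀ (w : S) (δ : ℚ), 0 < δ →
    (instanceCode S sys w δ ∈ L → (sys w).aStable.IsTrue) ∧
    (instanceCode S sys w δ ∉ L →
      ∃ φ, Formula.IsPerturbation (δ : ℝ) (sys w).aStable φ ∧ ¬ φ.IsTrue)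

end DeltaStab

end

/-!
Every threshold occurs monotonically in the stability formula, so the endpoint `εlo` is the hardest
choice of `ε` and `δlo` the best choice of `δ`, and likewise for the other thresholds. The truth of
the formula thus follows from a universal statement over a time `t` and an initial point `v`: no
trajectory that starts within `δlo` of the origin is in the box and at distance at least `εlo` at a
time in `[0, T]`, and none that starts within `δ'lo` is at distance at least `ε'lo` at a time within
`δ''lo` of `T'`.

A counterexample `(t, v)` is guessed approximately: a certificate is a list of integers, read as
multiples of `2 ^ (-N)` for a polynomially large `N`, and oracle queries yield the values of the
flow and of all constants with error much smaller than `c = 2 ^ (-|x|)`, where `x` is the input. The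
binary representation of the denominator of `δ` is part of `x`, so `c ≤ δ`. The verifier compares
with slack `c / 2`. Rounding an exact counterexample yields an accepted certificate. Conversely, an
accepted certificate falsifies the formula in which every atom `τ > 0` or `τ ≥ 0` is strengthened to
`τ > c` or `τ ≥ c`, and that is a `δ`-perturbation. So the complement of the language is in `NP`
relative to the oracle.
-/

noncomputable section

namespace DeltaStab

/-! ### Structured programs for oracle machines -/

/-- Structured programs over registers `0, 1, 2, …` that hold binary strings (as stacks). Register
`0` is used for input, output and oracle queries. The program `ite k P` continues with `P c` where
`c` is the top of register `k` (`none` if the register is empty), and `loop k P` repeats `P` while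
register `k` is nonempty. -/
inductive Prog : Type
  | skip
  | push (k : ℕ) (b : Bool)
  | pop (k : ℕ)
  | ask
  | seq (P Q : Prog)
  | ite (k : ℕ) (P : Option Bool → Prog)
  | loop (k : ℕ) (P : Prog)

/-- The contents of all registers. -/
abbrev Store := ℕ → List Bool

/-- `Exec g P s s' t`: with oracle `g`, the program `P` started on `s` terminates with `s'`, at
cost `t`. The length of the oracle's answer is included in the cost of a query, so that the cost
bounds the growth of the registers. -/
inductive Exec (g : List Bool → List Bool) : Prog → Store → Store → ℕ → Prop
  | skip (s : Store) : Exec g .skip s s 1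
  | push (s : Store) (k : ℕ) (b : Bool) :
      Exec g (.push k b) s (Function.update s k (b :: s k)) 1
  | pop (s : Store) (k : ℕ) : Exec g (.pop k) s (Function.update s k (s k).tail) 1
  | ask (s : Store) : Exec g .ask s (Function.update s 0 (g (s 0))) (3 + (g (s 0)).length)
  | seq {P Q : Prog} {s s₁ s₂ : Store} {t₁ t₂ : ℕ} (hP : Exec g P s s₁ t₁)
      (hQ : Exec g Q s₁ s₂ t₂) : Exec g (.seq P Q) s s₂ (t₁ + t₂ + 1)
  | ite {k : ℕ} {P : Option Bool → Prog} {s s' : Store} {t : ℕ}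
      (hP : Exec g (P (s k).head?) s s' t) : Exec g (.ite k P) s s' (t + 1)
  | loopNil {k : ℕ} {P : Prog} {s : Store} (hk : s k = []) : Exec g (.loop k P) s s 1
  | loopCons {k : ℕ} {P : Prog} {s s₁ s₂ : Store} {t₁ t₂ : ℕ} (hk : s k ≠ [])
      (hP : Exec g P s s₁ t₁) (hloop : Exec g (.loop k P) s₁ s₂ t₂) :
      Exec g (.loop k P) s s₂ (t₁ + t₂ + 1)

namespace Prog

/-- A strict upper bound of the registers used by a program. -/
def width : Prog → ℕ
  | skip => 1
  | push k _ => k + 1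
  | pop k => k + 1
  | ask => 1
  | seq P Q => max P.width Q.width
  | ite k P => max (k + 1) (Finset.univ.sup fun c => (P c).width)
  | loop k P => max (k + 1) P.width

/-- The stacks of pending programs that occur while `P` is executed on top of the stack `κ`,
except `κ` itself. -/
def conts : Prog → List Prog → Set (List Prog)
  | skip, κ => {skip :: κ}
  | push k b, κ => {push k b :: κ}
  | pop k, κ => {pop k :: κ}
  | ask, κ => {ask :: κ}
  | seq P Q, κ => insert (seq P Q :: κ) (P.conts (Q :: κ) ∪ Q.conts κ)
  | ite k P, κ => insert (ite k P :: κ) (⋃ c, (P c).conts κ)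
  | loop k P, κ => insert (loop k P :: κ) (P.conts (loop k P :: κ))

theorem cons_mem_conts (P : Prog) (κ : List Prog) : P :: κ ∈ P.conts κ := by
  cases P <;> simp [conts]

theorem finite_conts (P : Prog) (κ : List Prog) : (P.conts κ).Finite := by
  induction P generalizing κ with
  | seq P Q ihP ihQ => exact ((ihP _).union (ihQ _)).insert _
  | ite k P ih => exact (Set.finite_iUnion fun c => ih c κ).insert _
  | loop k P ih => exact (ih _).insert _
  | _ => exact Set.finite_singleton _

variable (P : Prog)

/-- The control states of the machine for `P`: stacks of pending programs, the empty one being the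
final state. -/
abbrev Cont : Type := {κ : List Prog // κ ∈ insert [] (P.conts [])}

instance : Finite P.Cont := (P.finite_conts []).insert _

variable {P} in
open Classical in
/-- The stack `κ` as a control state; the value for stacks that do not occur is irrelevant. -/
def Cont.ofList (κ : List Prog) : P.Cont :=
  if h : κ ∈ insert [] (P.conts []) then ⟨κ, h⟩ else ⟨[], Set.mem_insert _ _⟩

variable {P} in
theorem Cont.val_ofList {κ : List Prog} (h : κ ∈ insert [] (P.conts [])) :
    (Cont.ofList κ : P.Cont).1 = κ := by
  rw [Cont.ofList, dif_pos h]

/-- The labels of the machine for `P`. -/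
inductive Label : Type
  | run (κ : P.Cont)
  | ask
  | answer

instance : Finite P.Label :=
  Finite.of_surjective
    (fun | none => .ask | some none => .answer | some (some κ) => .run κ :
      Option (Option P.Cont) → P.Label)
    (by rintro (κ | _ | _); exacts [⟨some (some κ), rfl⟩, ⟨none, rfl⟩, ⟨some none, rfl⟩])

/-- The register `k` of a machine with the registers below `P.width + 1`. -/
def reg (k : ℕ) : Fin (P.width + 1) := Fin.ofNat _ k

/-- The first step in the execution of a stack of programs. The internal state of the machine
consists of the continuation after an oracle query and of the symbol read last. -/
def stmt : List Prog → Turing.TM2.Stmt (fun _ : Fin (P.width + 1) => Bool) P.Label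
    (P.Cont × Option Bool)
  | [] => .peek (P.reg 0) (fun v c => (v.1, c)) .halt
  | .skip :: κ => .goto fun _ => .run (.ofList κ)
  | .push k b :: κ => .push (P.reg k) (fun _ => b) (.goto fun _ => .run (.ofList κ))
  | .pop k :: κ => .pop (P.reg k) (fun v _ => v) (.goto fun _ => .run (.ofList κ))
  | .ask :: κ => .load (fun v => (.ofList κ, v.2)) (.goto fun _ => .ask)
  | .seq Q R :: κ => .goto fun _ => .run (.ofList (Q :: R :: κ))
  | .ite k Q :: κ => .peek (P.reg k) (fun v c => (v.1, c))
      (.goto fun v => .run (.ofList (Q v.2 :: κ)))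
  | .loop k Q :: κ => .peek (P.reg k) (fun v c => (v.1, c))
      (.goto fun v => .run (.ofList (if v.2.isSome then Q :: .loop k Q :: κ else κ)))

/-- The oracle machine that runs `P` and accepts if the result begins with `true`. -/
def machine : OracleTM where
  K := Fin (P.width + 1)
  Λ := P.Label
  σ := P.Cont × Option Bool
  input := P.reg 0
  query := P.reg 0
  main := .run (.ofList [P])
  ask := .ask
  answer := .answer
  start := (.ofList [], none)
  accept := fun v => v.2 == some true
  prog
    | .run κ => P.stmt κ.1
    | .ask => .halt
    | .answer => .goto fun v => .run v.1

/-- The registers of the machine for `P`. -/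
def restrict (s : Store) (k : Fin (P.width + 1)) : List Bool := s k

/-- The configuration of the machine with pending programs `κ` and registers `s`. -/
def cfg (κ : List Prog) (v : P.Cont × Option Bool) (s : Store) : P.machine.Cfg where
  l := some (.run (.ofList κ))
  var := v
  stk := P.restrict s

variable {P}

theorem restrict_reg {k : ℕ} (hk : k < P.width + 1) (s : Store) : P.restrict s (P.reg k) = s k :=
  congrArg s (Nat.mod_eq_of_lt hk)

theorem update_restrict {k : ℕ} (hk : k < P.width + 1) (s : Store) (x : List Bool) :
    Function.update (P.restrict s) (P.reg k) x = P.restrict (Function.update s k x) := by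
  funext j
  have hreg : (P.reg k : ℕ) = k := Nat.mod_eq_of_lt hk
  simp only [restrict, Function.update_apply, Fin.ext_iff, hreg]

theorem step_cfg (g : List Bool → List Bool) {κ : List Prog} (hκ : κ ∈ insert [] (P.conts []))
    (v : P.Cont × Option Bool) (s : Store) :
    P.machine.step g (P.cfg κ v s) = Turing.TM2.stepAux (P.stmt κ) v (P.restrict s) := by
  refine (if_neg (nofun : Label.run _ ≠ (.ask : P.Label))).trans ?_
  exact congrArg (fun κ => Turing.TM2.stepAux (P.stmt κ) v (P.restrict s)) (Cont.val_ofList hκ)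

/-- Within `t` steps, the machine for `P` gets from the pending programs `κ` and registers `s` to
`κ'` and `s'`. -/
def Runs (P : Prog) (g : List Bool → List Bool) (κ : List Prog) (s : Store) (κ' : List Prog)
    (s' : Store) (t : ℕ) : Prop :=
  ∀ v, ∃ n ≤ t, ∃ v', (P.machine.step g)^[n] (P.cfg κ v s) = P.cfg κ' v' s'

theorem Runs.trans {g : List Bool → List Bool} {κ κ' κ'' : List Prog} {s s' s'' : Store}
    {t t' : ℕ} (h : P.Runs g κ s κ' s' t) (h' : P.Runs g κ' s' κ'' s'' t') :
    P.Runs g κ s κ'' s'' (t + t') := by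
  intro v
  obtain ⟨n, hn, v', e⟩ := h v
  obtain ⟨n', hn', v'', e'⟩ := h' v'
  refine ⟨n' + n, by omega, v'', ?_⟩
  rw [Function.iterate_add_apply, e, e']

theorem Runs.of_step {g : List Bool → List Bool} {κ κ' : List Prog} {s s' : Store}
    (hκ : κ ∈ insert [] (P.conts []))
    (h : ∀ v, ∃ v', Turing.TM2.stepAux (P.stmt κ) v (P.restrict s) = P.cfg κ' v' s') :
    P.Runs g κ s κ' s' 1 := fun v =>
  let ⟨v', hv'⟩ := h v
  ⟨1, le_rfl, v', (step_cfg g hκ v s).trans hv'⟩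

theorem runs_ask (g : List Bool → List Bool) {κ : List Prog}
    (hκ : .ask :: κ ∈ insert [] (P.conts [])) (s : Store) :
    P.Runs g (.ask :: κ) s κ (Function.update s 0 (g (s 0))) 3 := by
  intro v
  have hask (w : P.Cont × Option Bool) (r : Fin (P.width + 1) → List Bool) :
      P.machine.step g ⟨some .ask, w, r⟩ =
        ⟨some .answer, w, Function.update r (P.reg 0) (g (r (P.reg 0)))⟩ := if_pos rfl
  have hanswer (w : P.Cont × Option Bool) (r : Fin (P.width + 1) → List Bool) :
      P.machine.step g ⟨some .answer, w, r⟩ = ⟨some (.run w.1), w, r⟩ :=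
    if_neg (nofun : Label.answer ≠ (.ask : P.Label))
  refine ⟨3, le_rfl, (.ofList κ, v.2), ?_⟩
  refine (congrArg (P.machine.step g)^[2] (step_cfg g hκ v s)).trans
    ((congrArg (P.machine.step g) (hask _ _)).trans ((hanswer _ _).trans ?_))
  exact congrArg (Turing.TM2.Cfg.mk _ _) (update_restrict (Nat.succ_pos _) s _)

theorem runs_of_exec {g : List Bool → List Bool} {Q : Prog} {s s' : Store} {t : ℕ}
    (h : Exec g Q s s' t) {κ : List Prog} (hQ : Q.conts κ ⊆ P.conts []) (hw : Q.width ≤ P.width) :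
    P.Runs g (Q :: κ) s κ s' t := by
  have hmem := Set.mem_insert_of_mem [] (hQ (Q.cons_mem_conts κ))
  induction h generalizing κ with
  | skip s => exact .of_step hmem fun v => ⟨v, rfl⟩
  | push s k b =>
    have hk : k < P.width + 1 := Nat.lt_succ_of_lt hw
    refine .of_step hmem fun v => ⟨v, ?_⟩
    rw [cfg, ← update_restrict hk, ← restrict_reg hk s]
    rfl
  | pop s k =>
    have hk : k < P.width + 1 := Nat.lt_succ_of_lt hw
    refine .of_step hmem fun v => ⟨v, ?_⟩
    rw [cfg, ← update_restrict hk, ← restrict_reg hk s]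
    rfl
  | ask s =>
    exact fun v => (runs_ask g hmem s v).imp fun _ => .imp_left (·.trans (Nat.le_add_right _ _))
  | @seq Q R s s₁ s₂ t₁ t₂ _ _ ihQ ihR =>
    simp only [conts, Set.insert_subset_iff, Set.union_subset_iff] at hQ
    simp only [width, max_le_iff] at hw
    have hfst := ihQ hQ.2.1 hw.1 (.inr (hQ.2.1 (cons_mem_conts _ _)))
    have hsnd := ihR hQ.2.2 hw.2 (.inr (hQ.2.2 (cons_mem_conts _ _)))
    have hstart : P.Runs g (.seq Q R :: κ) s (Q :: R :: κ) s 1 := .of_step hmem fun v => ⟨v, rfl⟩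
    exact (add_comm 1 (t₁ + t₂)) ▸ hstart.trans (hfst.trans hsnd)
  | @ite k Q s s' t _ ih =>
    simp only [conts, Set.insert_subset_iff, Set.iUnion_subset_iff] at hQ
    simp only [width, max_le_iff, Finset.sup_le_iff, Finset.mem_univ, true_imp_iff] at hw
    have hstart : P.Runs g (.ite k Q :: κ) s (Q (s k).head? :: κ) s 1 := .of_step hmem fun v =>
      ⟨(v.1, (s k).head?), by rw [← restrict_reg (Nat.lt_succ_of_lt hw.1) s]; rfl⟩
    exact (add_comm 1 t) ▸ hstart.trans (ih (hQ.2 _) (hw.2 _) (.inr (hQ.2 _ (cons_mem_conts _ _))))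
  | @loopNil k Q s hk =>
    simp only [width, max_le_iff] at hw
    have hreg := (restrict_reg (Nat.lt_succ_of_lt hw.1) s).trans hk
    exact .of_step hmem fun v => ⟨(v.1, none), by simp only [stmt, Turing.TM2.stepAux, hreg]; rfl⟩
  | @loopCons k Q s s₁ s₂ t₁ t₂ hk _ _ ihQ ihL =>
    have hfst := ihQ (hQ.trans' (Set.subset_insert _ _)) ((le_max_right _ _).trans hw)
    have hsnd := ihL hQ hw hmem
    have hreg := restrict_reg (Nat.lt_succ_of_lt ((le_max_left _ _).trans hw)) s
    have hstart : P.Runs g (.loop k Q :: κ) s (Q :: .loop k Q :: κ) s 1 :=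
      .of_step hmem fun v => ⟨(v.1, (s k).head?), by
        simp only [stmt, Turing.TM2.stepAux, hreg, List.isSome_head?.mpr hk, if_true]; rfl⟩
    refine (add_comm 1 (t₁ + t₂)) ▸ hstart.trans (.trans (hfst (.inr ?_)) hsnd)
    exact hQ (Set.mem_insert_of_mem _ (cons_mem_conts _ _))

end Prog

theorem OracleTM.iterate_step_of_halted (M : OracleTM) (g : List Bool → List Bool) {c : M.Cfg}
    (h : c.l = none) (n : ℕ) : (M.step g)^[n] c = c := by
  apply Function.iterate_fixed
  rw [OracleTM.step, h]

/-- The store with `x` in register `0`. -/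
def Store.single (x : List Bool) : Store := Function.update (fun _ => []) 0 x

theorem Prog.iterate_step_machine {g : List Bool → List Bool} {P : Prog} {x y : List Bool} {t : ℕ}
    (h : Exec g P (.single x) (.single y) t) :
    ∃ n ≤ t + 1, ∃ c : P.machine.Cfg, (P.machine.step g)^[n] (P.machine.initCfg x) = c ∧
      c.l = none ∧ (P.machine.accept c.var = true ↔ y.head? = some true) := by
  obtain ⟨n, hn, v, e⟩ := Prog.runs_of_exec h subset_rfl le_rfl P.machine.start
  have hinit : P.machine.initCfg x = P.cfg [P] P.machine.start (.single x) :=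
    congrArg (Turing.TM2.Cfg.mk _ _) (update_restrict (Nat.succ_pos _) (fun _ => []) x)
  refine ⟨n + 1, by omega, _, rfl, ?_⟩
  rw [Function.iterate_succ_apply', hinit, e, step_cfg g (Set.mem_insert _ _)]
  simp only [stmt, Turing.TM2.stepAux, restrict_reg (Nat.succ_pos _), machine, beq_iff_eq,
    true_and]
  rfl

theorem mem_PTime_of_exec {g : List Bool → List Bool} {L : Set (List Bool)} (P : Prog)
    (p : Polynomial ℕ) (f : List Bool → List Bool)
    (hP : ∀ x, ∃ t ≤ p.eval x.length, Exec g P (.single x) (.single (f x)) t)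
    (hf : ∀ x, (f x).head? = some true ↔ x ∈ L) : L ∈ PTime g := by
  refine ⟨P.machine, p + 1, fun x => ?_⟩
  obtain ⟨t, ht, hexec⟩ := hP x
  obtain ⟨n, hn, c, hc, hhalt, haccept⟩ := P.iterate_step_machine hexec
  obtain ⟨k, hk⟩ : ∃ k, (p + 1).eval x.length = k + n :=
    Nat.exists_eq_add_of_le' (by rw [Polynomial.eval_add, Polynomial.eval_one]; omega)
  rw [OracleTM.DecidesWithin, hk, Function.iterate_add_apply, hc,
    OracleTM.iterate_step_of_halted _ _ hhalt]
  exact ⟨hhalt, haccept.trans (hf x)⟩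

/-! ### Polynomial time string functions -/

theorem eval_le_eval (p : Polynomial ℕ) {a b : ℕ} (h : a ≤ b) : p.eval a ≤ p.eval b := by
  rw [Polynomial.eval_eq_sum, Polynomial.eval_eq_sum]
  exact Finset.sum_le_sum fun i _ => Nat.mul_le_mul_left _ (Nat.pow_le_pow_left h i)

/-- The store whose first registers hold the given strings, the other registers being empty. -/
def Store.ofList (l : List (List Bool)) : Store := fun k => l.getD k []

open Store (ofList)

@[simp]
theorem Store.ofList_apply (l : List (List Bool)) (k : ℕ) : ofList l k = l.getD k [] := rfl

theorem Store.single_eq_ofList (x : List Bool) : single x = ofList [x] := by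
  funext k
  rcases k with _ | k <;> rfl

@[simp]
theorem Store.update_ofList {l : List (List Bool)} {k : ℕ} (hk : k < l.length) (x : List Bool) :
    Function.update (ofList l) k x = ofList (l.set k x) := by
  funext i
  obtain rfl | hi := eq_or_ne i k
  · simp [hk]
  · simp [Function.update_of_ne hi, List.getElem?_set_ne hi.symm]

theorem Store.ofList_append_nil (l : List (List Bool)) : ofList (l ++ [[]]) = ofList l := by
  funext k
  simp only [ofList_apply, List.getD_eq_getElem?_getD]
  rcases lt_trichotomy k l.length with hk | rfl | hk
  · rw [List.getElem?_append_left hk]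
  · simp
  · rw [List.getElem?_eq_none (by simp; omega), List.getElem?_eq_none hk.le]

theorem Store.ofList_singleton (x : List Bool) : ofList [x] = ofList [x, [], []] :=
  ((ofList_append_nil [x, []]).trans (ofList_append_nil [x])).symm

theorem length_update_le {s : Store} {j : ℕ} {x : List Bool} {t : ℕ}
    (hx : x.length ≤ (s j).length + t) (k : ℕ) :
    (Function.update s j x k).length ≤ (s k).length + t := by
  obtain rfl | hk := eq_or_ne k j
  · rwa [Function.update_self]
  · rw [Function.update_of_ne hk]
    omega

theorem Exec.length_le {g : List Bool → List Bool} {P : Prog} {s s' : Store} {t : ℕ}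
    (h : Exec g P s s' t) (k : ℕ) : (s' k).length ≤ (s k).length + t := by
  induction h with
  | skip s => omega
  | push s j b => exact length_update_le (by simp) k
  | pop s j => exact length_update_le (by rw [List.length_tail]; omega) k
  | ask s => exact length_update_le (by omega) k
  | seq _ _ ih₁ ih₂ => omega
  | ite _ ih => omega
  | loopNil _ => omega
  | loopCons _ _ _ ih₁ ih₂ => omega

/-- Renaming of registers. -/
def Prog.rename (ρ : ℕ → ℕ) : Prog → Prog
  | skip => skip
  | push k b => push (ρ k) b
  | pop k => pop (ρ k)
  | ask => ask
  | seq P Q => seq (P.rename ρ) (Q.rename ρ)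
  | ite k P => ite (ρ k) fun c => (P c).rename ρ
  | loop k P => loop (ρ k) (P.rename ρ)

theorem Store.extend_update {ρ : ℕ → ℕ} (hρ : ρ.Injective) (s S : Store) (k : ℕ) (x : List Bool) :
    Function.extend ρ (Function.update s k x) S =
      Function.update (Function.extend ρ s S) (ρ k) x := by
  funext j
  by_cases hj : ∃ i, ρ i = j
  · obtain ⟨i, rfl⟩ := hj
    simp only [hρ.extend_apply, Function.update_apply, hρ.eq_iff]
  · rw [Function.extend_apply' _ _ _ hj, Function.update_of_ne fun h => hj ⟨k, h.symm⟩,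
      Function.extend_apply' _ _ _ hj]

/-- Register `0` has to be fixed because oracle queries use it. -/
theorem Exec.rename {g : List Bool → List Bool} {P : Prog} {s s' : Store} {t : ℕ}
    (h : Exec g P s s' t) {ρ : ℕ → ℕ} (hρ : ρ.Injective) (hρ0 : ρ 0 = 0) (S : Store) :
    Exec g (P.rename ρ) (Function.extend ρ s S) (Function.extend ρ s' S) t := by
  induction h with
  | skip s => exact .skip _
  | push s k b =>
    rw [Store.extend_update hρ, ← hρ.extend_apply s S k]
    exact .push _ _ _
  | pop s k =>
    rw [Store.extend_update hρ, ← hρ.extend_apply s S k]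
    exact .pop _ _
  | ask s =>
    rw [Store.extend_update hρ, ← hρ.extend_apply s S 0, hρ0]
    exact .ask _
  | seq _ _ ih₁ ih₂ => exact .seq ih₁ ih₂
  | @ite k P s s' t _ ih => exact .ite (by rwa [hρ.extend_apply])
  | loopNil hk => exact .loopNil (by rwa [hρ.extend_apply])
  | loopCons hk _ _ ih₁ ih₂ => exact .loopCons (by rwa [hρ.extend_apply]) ih₁ ih₂

/-- The program acting on register `0` and, instead of registers `1, 2, …`, on `3, 4, …`. -/
def Prog.shift (P : Prog) : Prog := P.rename fun k => if k = 0 then 0 else k + 2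

theorem Exec.shift {g : List Bool → List Bool} {P : Prog} {x y : List Bool} {t : ℕ}
    (h : Exec g P (ofList [x]) (ofList [y]) t) (a b : List Bool) :
    Exec g P.shift (ofList [x, a, b]) (ofList [y, a, b]) t := by
  have hinj : Function.Injective fun k : ℕ => if k = 0 then 0 else k + 2 := by
    intro i j hij
    grind
  have hext (z : List Bool) : Function.extend (fun k : ℕ => if k = 0 then 0 else k + 2)
      (ofList [z]) (ofList [[], a, b]) = ofList [z, a, b] := by
    funext k
    rcases k with _ | _ | _ | k
    · exact hinj.extend_apply _ _ 0
    · exact Function.extend_apply' _ _ _ (by grind)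
    · exact Function.extend_apply' _ _ _ (by grind)
    · exact hinj.extend_apply _ _ (k + 1)
  exact hext x ▸ hext y ▸ h.rename hinj rfl _

/-- Pop the bits of register `k` one by one and run `P b` for each bit `b`. -/
def Prog.drain (k : ℕ) (P : Bool → Prog) : Prog :=
  .loop k (.ite k fun c => c.elim .skip fun b => .seq (.pop k) (P b))

theorem Exec.drain {g : List Bool → List Bool} {σ : Type} {k : ℕ} {P : Bool → Prog}
    (st : σ → Store) (step : σ → Bool → σ) (c : ℕ) (l : List Bool) (a : σ)
    (hP : ∀ l₁ b l₂, l = l₁ ++ b :: l₂ → ∃ t ≤ c, Exec g (P b)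
      (Function.update (st (l₁.foldl step a)) k l₂)
      (Function.update (st (step (l₁.foldl step a) b)) k l₂) t) :
    ∃ t ≤ (c + 4) * l.length + 1, Exec g (.drain k P) (Function.update (st a) k l)
      (Function.update (st (l.foldl step a)) k []) t := by
  induction l generalizing a with
  | nil => exact ⟨1, by simp, .loopNil (Function.update_self _ _ _)⟩
  | cons b l ih =>
    obtain ⟨t, ht, hbody⟩ := hP [] b l rfl
    obtain ⟨t', ht', hloop⟩ := ih (step a b) fun l₁ b' l₂ h => hP (b :: l₁) b' l₂ (by rw [h]; rfl)
    have hpop : Exec g (.pop k) (Function.update (st a) k (b :: l))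
        (Function.update (st a) k l) 1 := by
      simpa only [Function.update_self, Function.update_idem, List.tail_cons] using
        Exec.pop (g := g) (Function.update (st a) k (b :: l)) k
    refine ⟨1 + t + 1 + 1 + t' + 1, by rw [List.length_cons, mul_add]; omega, ?_⟩
    refine .loopCons (by rw [Function.update_self]; exact List.cons_ne_nil _ _) (.ite ?_) hloop
    rw [Function.update_self]
    exact .seq hpop hbody

/-- A function oracle with polynomially long values. -/
structure Oracle where
  ask : List Bool → List Bool
  length_ask : ∃ p : Polynomial ℕ, ∀ x, (ask x).length ≤ p.eval x.length

/-- Types with codes of their elements as binary strings. -/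
class Enc (α : Type) where
  enc : α → List Bool

open Enc (enc)

instance : Enc (List Bool) := ⟨fun x => x⟩

@[simp]
theorem enc_list (x : List Bool) : enc x = x := rfl

instance : Enc Bool := ⟨fun b => [b]⟩

@[simp]
theorem enc_bool (b : Bool) : enc b = [b] := rfl

section

variable {g : Oracle} {α β γ : Type} [Enc α] [Enc β] [Enc γ]

/-- `P` takes the store `a x` to the store `b x` in time polynomial in the length of the code of
`x`. -/
def PolyExec (g : Oracle) (P : Prog) (a b : α → Store) : Prop :=
  ∃ p : Polynomial ℕ, ∀ x, ∃ t ≤ p.eval (enc x).length, Exec g.ask P (a x) (b x) t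

/-- The values of `f` are polynomially long. -/
def PolyLen (f : α → List Bool) : Prop :=
  ∃ p : Polynomial ℕ, ∀ x, (f x).length ≤ p.eval (enc x).length

/-- The function `f` is computed (on codes) by a program in polynomial time with oracle `g`. -/
@[fun_prop]
def FP (g : Oracle) (f : α → β) : Prop :=
  ∃ P : Prog, PolyExec g P (fun x : α => ofList [enc x]) (fun x => ofList [enc (f x)])

theorem PolyLen.enc : PolyLen fun x : α => enc x := ⟨.X, fun x => by rw [Polynomial.eval_X]⟩

theorem PolyLen.reverse {f : α → List Bool} (hf : PolyLen f) : PolyLen fun x => (f x).reverse := by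
  simpa only [PolyLen, List.length_reverse] using hf

theorem FP.polyLen {f : α → β} (hf : FP g f) : PolyLen fun x => enc (f x) := by
  obtain ⟨P, p, hp⟩ := hf
  refine ⟨.X + p, fun x => ?_⟩
  obtain ⟨t, ht, e⟩ := hp x
  rw [Polynomial.eval_add, Polynomial.eval_X]
  exact (e.length_le 0).trans (Nat.add_le_add_left ht _)

namespace PolyExec

theorem congr {P : Prog} {a a' b b' : α → Store} (h : PolyExec g P a b)
    (ha : ∀ x, a' x = a x) (hb : ∀ x, b' x = b x) : PolyExec g P a' b' := by
  obtain rfl : a' = a := funext ha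
  obtain rfl : b' = b := funext hb
  exact h

theorem seq {P Q : Prog} {a b c : α → Store} (h₁ : PolyExec g P a b) (h₂ : PolyExec g Q b c) :
    PolyExec g (.seq P Q) a c := by
  obtain ⟨p, hp⟩ := h₁
  obtain ⟨q, hq⟩ := h₂
  refine ⟨p + q + 1, fun x => ?_⟩
  obtain ⟨t₁, ht₁, e₁⟩ := hp x
  obtain ⟨t₂, ht₂, e₂⟩ := hq x
  refine ⟨t₁ + t₂ + 1, ?_, .seq e₁ e₂⟩
  simp only [Polynomial.eval_add, Polynomial.eval_one]
  omega

theorem push (k : ℕ) (b : Bool) (a : α → Store) :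
    PolyExec g (.push k b) a fun x => Function.update (a x) k (b :: a x k) :=
  ⟨1, fun x => ⟨1, by rw [Polynomial.eval_one], .push _ _ _⟩⟩

theorem pop (k : ℕ) (a : α → Store) :
    PolyExec g (.pop k) a fun x => Function.update (a x) k (a x k).tail :=
  ⟨1, fun x => ⟨1, by rw [Polynomial.eval_one], .pop _ _⟩⟩

theorem shift {P : Prog} {h : β → γ} {u : α → β}
    (hP : PolyExec g P (fun x => ofList [enc x]) fun x => ofList [enc (h x)])
    (hu : PolyLen fun x => enc (u x)) (a b : α → List Bool) :
    PolyExec g P.shift (fun x => ofList [enc (u x), a x, b x])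
      (fun x => ofList [enc (h (u x)), a x, b x]) := by
  obtain ⟨p, hp⟩ := hP
  obtain ⟨q, hq⟩ := hu
  refine ⟨p.comp q, fun x => ?_⟩
  obtain ⟨t, ht, e⟩ := hp (u x)
  rw [Polynomial.eval_comp]
  exact ⟨t, ht.trans (eval_le_eval p (hq x)), e.shift _ _⟩

theorem drain {σ : Type} {k : ℕ} {P : Bool → Prog} {l : α → List Bool} (hl : PolyLen l)
    (st : α → σ → Store) (step : σ → Bool → σ) (a : α → σ)
    (hP : ∃ p : Polynomial ℕ, ∀ x l₁ b l₂, l x = l₁ ++ b :: l₂ →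
      ∃ t ≤ p.eval (enc x).length, Exec g.ask (P b)
        (Function.update (st x (l₁.foldl step (a x))) k l₂)
        (Function.update (st x (step (l₁.foldl step (a x)) b)) k l₂) t) :
    PolyExec g (.drain k P) (fun x => Function.update (st x (a x)) k (l x))
      (fun x => Function.update (st x ((l x).foldl step (a x))) k []) := by
  obtain ⟨q, hq⟩ := hl
  obtain ⟨p, hp⟩ := hP
  refine ⟨(p + 4) * q + 1, fun x => ?_⟩
  obtain ⟨t, ht, e⟩ := Exec.drain (st x) step (p.eval (Enc.enc x).length) (l x) (a x) (hp x)
  refine ⟨t, ht.trans ?_, e⟩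
  simp only [Polynomial.eval_add, Polynomial.eval_mul, Polynomial.eval_ofNat, Polynomial.eval_one]
  gcongr
  exact hq x

theorem clear (k : ℕ) (a : α → Store) (hl : PolyLen fun x => a x k) :
    PolyExec g (.drain k fun _ => .skip) a fun x => Function.update (a x) k [] := by
  have h := drain (g := g) (k := k) hl (fun x (_ : Unit) => a x) (fun a _ => a) (fun _ => ())
    ⟨1, fun x l₁ b l₂ _ => ⟨1, by rw [Polynomial.eval_one], .skip _⟩⟩
  exact h.congr (fun x => (Function.update_eq_self _ _).symm) fun x => rfl

end PolyExec

/-- Move register `k`, reversed, on top of register `j`. -/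
def Prog.move (k j : ℕ) : Prog := .drain k fun b => .push j b

theorem foldl_flip_cons (l a : List Bool) :
    l.foldl (fun a b => b :: a) a = l.reverse ++ a :=
  (List.foldr_reverse ..).symm.trans List.foldr_cons_eq_append'

theorem PolyExec.move {k j : ℕ} (hkj : k ≠ j) (a : α → Store) (hl : PolyLen fun x => a x k) :
    PolyExec g (.move k j) a fun x =>
      Function.update (Function.update (a x) j ((a x k).reverse ++ a x j)) k [] := by
  have h := drain (g := g) (k := k) (P := .push j) hl (fun x b => Function.update (a x) j b)
    (fun a b => b :: a) (fun x => a x j) ⟨1, fun x l₁ b l₂ _ => ⟨1, by rw [Polynomial.eval_one], by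
      have hpush := Exec.push (g := g.ask) (Function.update (Function.update (a x) j
        (l₁.foldl (fun a b => b :: a) (a x j))) k l₂) j b
      simpa only [Function.update_comm hkj, Function.update_idem, Function.update_self,
        Function.update_of_ne hkj.symm] using hpush⟩⟩
  refine h.congr (fun x => ?_) fun x => by rw [foldl_flip_cons]
  rw [Function.update_eq_self, Function.update_eq_self]

theorem PolyExec.copy :
    ∃ P, PolyExec g P (fun x : α => ofList [enc x, [], []])
      (fun x => ofList [enc x, [], (enc x).reverse]) := by
  have hfold (l a : List Bool) : l.foldl (fun (a : List Bool × List Bool) b => (b :: a.1, b :: a.2))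
      (a, a) = (l.reverse ++ a, l.reverse ++ a) := by
    induction l generalizing a with
    | nil => rfl
    | cons b l ih => simp [ih]
  have hdrain := drain (g := g) (k := 0) (P := fun b => .seq (.push 1 b) (.push 2 b)) .enc
    (fun (_ : α) a => ofList [[], a.1, a.2]) (fun a b => (b :: a.1, b :: a.2)) (fun _ => ([], []))
    ⟨3, fun x l₁ b l₂ _ => ⟨3, by rw [Polynomial.eval_ofNat], by
      generalize l₁.foldl _ _ = a
      have hpush := Exec.push (g := g.ask) (ofList [l₂, a.1, a.2]) 1 b
      simpa using hpush.seq (.push _ 2 b)⟩⟩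
  have hmove := move (g := g) (k := 1) (j := 0) (by simp)
    (fun x : α => ofList [[], (enc x).reverse, (enc x).reverse]) PolyLen.enc.reverse
  exact ⟨_, (hdrain.seq (hmove.congr (fun x => by simp [hfold]) fun x => rfl)).congr
    (fun x => by simp) fun x => by simp⟩

theorem FP.exists_both {f : α → β} {h : α → γ} (hf : FP g f) (hh : FP g h) :
    ∃ P, PolyExec g P (fun x => ofList [enc x])
      (fun x => ofList [enc (h x), (enc (f x)).reverse, []]) := by
  have hl := hf.polyLen
  obtain ⟨P, hP⟩ := hf
  obtain ⟨Q, hQ⟩ := hh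
  obtain ⟨R, hcopy⟩ := PolyExec.copy (g := g) (α := α)
  have hrunP := hP.shift (u := fun x => x) .enc (fun _ => []) fun x => (enc x).reverse
  have hmove := PolyExec.move (g := g) (k := 0) (j := 1) (by simp)
    (fun x => ofList [enc (f x), [], (enc x).reverse]) hl
  have hback := PolyExec.move (g := g) (k := 2) (j := 0) (by simp)
    (fun x => ofList [[], (enc (f x)).reverse, (enc x).reverse]) PolyLen.enc.reverse
  have hrunQ := hQ.shift (u := fun x => x) .enc (fun x => (enc (f x)).reverse) fun _ => []
  simp only [Store.ofList_apply, Store.update_ofList, List.getD_cons_zero, List.getD_cons_succ,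
    List.set_cons_zero, List.set_cons_succ, List.length_cons, List.length_nil, List.append_nil,
    List.reverse_reverse, Nat.zero_lt_succ, Nat.reduceAdd, Nat.reduceLT] at hmove hback
  exact ⟨_, (hcopy.seq (hrunP.seq (hmove.seq (hback.seq hrunQ)))).congr
    (fun x => Store.ofList_singleton _) fun x => rfl⟩

namespace FP

@[fun_prop]
theorem id : FP g fun x : α => x :=
  ⟨.skip, 1, fun x => ⟨1, by rw [Polynomial.eval_one], .skip _⟩⟩

theorem recode {f : α → β} {f' : α → γ} (hf : FP g f) (h : ∀ x, enc (f' x) = enc (f x)) :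
    FP g f' := by
  obtain ⟨P, hP⟩ := hf
  exact ⟨P, hP.congr (fun _ => rfl) fun x => by rw [h]⟩

theorem enc : FP g fun x : α => enc x := id.recode fun _ => rfl

@[fun_prop]
theorem comp {h : β → γ} {f : α → β} (hh : FP g h) (hf : FP g f) : FP g fun x => h (f x) := by
  obtain ⟨p, hp⟩ := hf.polyLen
  obtain ⟨P, hP⟩ := hf
  obtain ⟨Q, q, hq⟩ := hh
  refine ⟨_, hP.seq (Q := Q) ⟨q.comp p, fun x => ?_⟩⟩
  obtain ⟨t, ht, e⟩ := hq (f x)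
  exact ⟨t, ht.trans (by rw [Polynomial.eval_comp]; exact eval_le_eval q (hp x)), e⟩

@[fun_prop]
theorem cons (b : Bool) : FP g fun x : List Bool => b :: x :=
  ⟨_, (PolyExec.push 0 b fun x : List Bool => ofList [x]).congr (fun _ => rfl) fun x => by simp⟩

@[fun_prop]
theorem tail : FP g fun x : List Bool => x.tail :=
  ⟨_, (PolyExec.pop 0 fun x : List Bool => ofList [x]).congr (fun _ => rfl) fun x => by simp⟩

@[fun_prop]
theorem ask : FP g fun x => g.ask x := by
  obtain ⟨p, hp⟩ := g.length_ask
  refine ⟨.ask, 3 + p, fun x => ⟨_, ?_, by simpa using Exec.ask (g := g.ask) (ofList [x])⟩⟩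
  rw [Polynomial.eval_add, Polynomial.eval_ofNat]
  exact Nat.add_le_add_left (hp x) 3

theorem nil : FP g fun _ : α => ([] : List Bool) :=
  ⟨_, (PolyExec.clear 0 (fun x : α => ofList [Enc.enc x]) .enc).congr (fun _ => rfl) fun x => by
    simp⟩

theorem constString (l : List Bool) : FP g fun _ : α => l := by
  induction l with
  | nil => exact nil
  | cons b l ih => exact (cons b).comp ih

@[fun_prop]
theorem const (c : β) : FP g fun _ : α => c := (constString (Enc.enc c)).recode fun _ => rfl

@[fun_prop]
theorem cond {u : α → Bool} {f h : α → β} (hu : FP g u) (hf : FP g f) (hh : FP g h) :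
    FP g fun x => bif u x then f x else h x := by
  obtain ⟨P, hP⟩ := hu.exists_both (g := g) id
  have hpop := PolyExec.pop (g := g) 1 fun x : α => ofList [Enc.enc x, [u x], []]
  have hbranch {f : α → β} (hf : FP g f) :
      ∃ Q, PolyExec g Q (fun x => ofList [Enc.enc x, [u x], []])
        fun x => ofList [Enc.enc (f x)] := by
    obtain ⟨Q, hQ⟩ := hf
    have hrun := hQ.shift (u := fun x => x) .enc (fun _ => []) fun _ => []
    exact ⟨_, (hpop.seq (hrun.congr (fun x => by simp) fun x => rfl)).congr (fun _ => rfl) fun x =>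
      Store.ofList_singleton _⟩
  obtain ⟨Q, q, hQ⟩ := hbranch hf
  obtain ⟨R, r, hR⟩ := hbranch hh
  refine ⟨_, hP.seq (Q := .ite 1 fun c => bif c.getD false then Q else R) ⟨q + r + 1, fun x => ?_⟩⟩
  obtain ⟨t₁, ht₁, e₁⟩ := hQ x
  obtain ⟨t₂, ht₂, e₂⟩ := hR x
  simp only [Polynomial.eval_add, Polynomial.eval_one]
  cases hux : u x
  · exact ⟨t₂ + 1, by omega, .ite (by simpa [hux] using e₂)⟩
  · exact ⟨t₁ + 1, by omega, .ite (by simpa [hux] using e₁)⟩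

theorem foldr {u : α → List Bool} {f : α → β} {step : Bool → β → β} (hu : FP g u) (hf : FP g f)
    (hstep : ∀ b, FP g (step b))
    (hlen : ∃ p : Polynomial ℕ, ∀ x l, l <:+ u x →
      (Enc.enc (l.foldr step (f x))).length ≤ p.eval (Enc.enc x).length) :
    FP g fun x => (u x).foldr step (f x) := by
  have hl := hu.polyLen.reverse
  obtain ⟨P, hP⟩ := hu.exists_both hf
  choose Q q hQ using hstep
  obtain ⟨p, hp⟩ := hlen
  have hloop := PolyExec.drain (g := g) (k := 1) (P := fun b => (Q b).shift) hl
    (fun (_ : α) a => ofList [Enc.enc a, [], []]) (fun a b => step b a) f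
    ⟨(q true + q false).comp p, fun x l₁ b l₂ hlx => by
      have hsuffix : l₁.reverse <:+ u x :=
        ⟨(b :: l₂).reverse, by rw [← List.reverse_append, ← hlx]; exact List.reverse_reverse _⟩
      have hle := hp x _ hsuffix
      rw [List.foldr_reverse] at hle
      obtain ⟨t, ht, e⟩ := hQ b (l₁.foldl (fun a b => step b a) (f x))
      refine ⟨t, ht.trans ((eval_le_eval _ hle).trans ?_), by simpa using e.shift l₂ []⟩
      rw [Polynomial.eval_comp, Polynomial.eval_add]
      cases b <;> omega⟩
  refine ⟨_, hP.seq (hloop.congr (fun x => by simp) fun x => ?_)⟩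
  rw [List.foldl_reverse, Store.update_ofList (by simp)]
  exact Store.ofList_singleton _

@[fun_prop]
theorem append {f h : α → List Bool} (hf : FP g f) (hh : FP g h) : FP g fun x => f x ++ h x := by
  obtain ⟨p, hp⟩ := hf.polyLen
  obtain ⟨q, hq⟩ := hh.polyLen
  refine (hf.foldr hh cons ⟨p + q, fun x l hl => ?_⟩).recode fun x => by
    rw [List.foldr_cons_eq_append']
  rw [List.foldr_cons_eq_append', enc_list, List.length_append, Polynomial.eval_add]
  exact Nat.add_le_add (hl.length_le.trans (hp x)) (hq x)

@[fun_prop]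
theorem reverse : FP g fun x : List Bool => x.reverse := by
  have hfold (l : List Bool) : l.foldr (fun b a => a ++ [b]) [] = l.reverse := by
    induction l with
    | nil => rfl
    | cons b l ih => rw [List.foldr_cons, ih, List.reverse_cons]
  refine (id.foldr nil (step := fun b a => a ++ [b]) (fun b => by fun_prop)
    ⟨.X, fun x l hl => ?_⟩).recode fun x => by rw [hfold]
  rw [hfold, enc_list, List.length_reverse, Polynomial.eval_X]
  exact hl.length_le

@[fun_prop]
theorem isEmpty : FP g fun x : List Bool => x.isEmpty :=
  (id.foldr (const true) (step := fun _ _ => false) (fun _ => const _)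
    ⟨1, fun x l _ => by simp⟩).recode fun x => by cases x <;> rfl

@[fun_prop]
theorem headD : FP g fun x : List Bool => x.headD false :=
  (id.foldr (const false) (step := fun b _ => b) (fun _ => const _)
    ⟨1, fun x l _ => by simp⟩).recode fun x => by cases x <;> rfl

theorem iterate {u : α → List Bool} {f : α → β} {h : β → β} (hu : FP g u) (hf : FP g f)
    (hh : FP g h) (c : ℕ) (hc : ∀ y, (Enc.enc (h y)).length ≤ (Enc.enc y).length + c) :
    FP g fun x => h^[(u x).length] (f x) := by
  have hfold (l : List Bool) (a : β) : l.foldr (fun _ => h) a = h^[l.length] a := by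
    induction l with
    | nil => rfl
    | cons b l ih => rw [List.foldr_cons, ih, List.length_cons, Function.iterate_succ_apply']
  have hgrowth (j : ℕ) (a : β) : (Enc.enc (h^[j] a)).length ≤ (Enc.enc a).length + j * c := by
    induction j with
    | zero => simp
    | succ j ih =>
      rw [Function.iterate_succ_apply', Nat.succ_mul]
      exact (hc _).trans (by omega)
  obtain ⟨p, hp⟩ := hu.polyLen
  obtain ⟨q, hq⟩ := hf.polyLen
  refine (hu.foldr hf (fun _ => hh) ⟨q + p * c, fun x l hl => ?_⟩).recode fun x => by rw [hfold]
  rw [hfold]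
  refine (hgrowth _ _).trans ?_
  rw [Polynomial.eval_add, Polynomial.eval_mul, Polynomial.eval_natCast]
  exact Nat.add_le_add (hq x) (Nat.mul_le_mul_right _ (hl.length_le.trans (hp x)))

end FP

/-! ### Coded lists and pairs -/

/-- Put the string `x` in front of the list of strings coded by `y`. -/
def lcons (x y : List Bool) : List Bool := x.foldr (fun b z => true :: b :: z) (false :: y)

/-- Drop the first bit of the first string of a coded list, if there is one. -/
def dropBit (z : List Bool) : List Bool := bif z.headD false then z.tail.tail else z

/-- Move the first bit of the first string of a coded list, if there is one, to the very end. -/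
def rotateBit (z : List Bool) : List Bool :=
  bif z.headD false then z.tail.tail ++ [z.tail.headD false] else z

/-- A coded list of strings without the first string. -/
def ltail (z : List Bool) : List Bool := (dropBit^[z.length] z).tail

/-- The first string of a coded list of strings. -/
def lhead (z : List Bool) : List Bool :=
  List.tail^[(false :: ltail z).length] (rotateBit^[z.length] z)

@[simp]
theorem encodeList_nil : encodeList [] = [] := rfl

@[simp]
theorem encodeList_cons (x : List Bool) (l : List (List Bool)) :
    encodeList (x :: l) = lcons x (encodeList l) := by
  induction x with
  | nil => rfl
  | cons b x ih => exact congrArg (true :: b :: ·) ih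

theorem lcons_append (x y z : List Bool) : lcons x y ++ z = lcons x (y ++ z) := by
  induction x with
  | nil => rfl
  | cons b x ih => exact congrArg (true :: b :: ·) ih

@[simp]
theorem length_lcons (x y : List Bool) : (lcons x y).length = 2 * x.length + 1 + y.length := by
  induction x with
  | nil => exact Nat.add_comm _ _
  | cons b x ih =>
    change (lcons x y).length + 2 = _
    rw [ih, List.length_cons]
    omega

theorem iterate_dropBit_lcons (x y : List Bool) {j : ℕ} (hj : x.length ≤ j) :
    dropBit^[j] (lcons x y) = false :: y := by
  induction x generalizing j with
  | nil => exact Function.iterate_fixed rfl j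
  | cons b x ih =>
    obtain ⟨j, rfl⟩ := Nat.exists_eq_add_of_le' (Nat.one_le_of_lt hj)
    exact ih (Nat.le_of_succ_le_succ hj)

theorem iterate_rotateBit_lcons (x y : List Bool) {j : ℕ} (hj : x.length ≤ j) :
    rotateBit^[j] (lcons x y) = false :: y ++ x := by
  induction x generalizing j y with
  | nil =>
    rw [List.append_nil]
    exact Function.iterate_fixed rfl j
  | cons b x ih =>
    obtain ⟨j, rfl⟩ := Nat.exists_eq_add_of_le' (Nat.one_le_of_lt hj)
    change rotateBit^[j] (lcons x y ++ [b]) = _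
    rw [lcons_append, ih _ (Nat.le_of_succ_le_succ hj), List.cons_append, List.append_assoc]
    rfl

@[simp]
theorem ltail_lcons (x y : List Bool) : ltail (lcons x y) = y := by
  rw [ltail, iterate_dropBit_lcons x y (by rw [length_lcons]; omega), List.tail_cons]

@[simp]
theorem lhead_lcons (x y : List Bool) : lhead (lcons x y) = x := by
  rw [lhead, ltail_lcons, iterate_rotateBit_lcons x y (by rw [length_lcons]; omega),
    List.tail_iterate, List.drop_left]

theorem length_dropBit_le (z : List Bool) : (dropBit z).length ≤ z.length := by
  rw [dropBit]
  cases z.headD false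
  · exact le_rfl
  · simp only [cond_true, List.length_tail]
    omega

theorem length_rotateBit_le (z : List Bool) : (rotateBit z).length ≤ z.length := by
  rcases z with _ | ⟨b, z⟩
  · exact le_rfl
  · cases b
    · exact le_rfl
    · change (z.tail ++ [_]).length ≤ _
      simp only [List.length_append, List.length_tail, List.length_cons, List.length_nil]
      omega

theorem length_ltail_le (z : List Bool) : (ltail z).length ≤ z.length := by
  have h (j : ℕ) : (dropBit^[j] z).length ≤ z.length := by
    induction j with
    | zero => exact le_rfl
    | succ j ih =>
      rw [Function.iterate_succ_apply']
      exact (length_dropBit_le _).trans ih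
  rw [ltail, List.length_tail]
  exact (Nat.sub_le _ _).trans (h _)

@[simp]
theorem length_unary (k : ℕ) : (unary k).length = k := List.length_replicate

theorem unary_append_unary (j k : ℕ) : unary j ++ unary k = unary (j + k) :=
  List.replicate_append_replicate

instance : Enc (α × β) := ⟨fun p => lcons (enc p.1) (enc p.2)⟩

theorem enc_prod (p : α × β) : enc p = lcons (enc p.1) (enc p.2) := rfl

theorem length_enc_prod (p : α × β) :
    (enc p).length = 2 * (enc p.1).length + 1 + (enc p.2).length := length_lcons _ _

namespace FP

@[fun_prop]
theorem lcons {f h : α → List Bool} (hf : FP g f) (hh : FP g h) :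
    FP g fun x => lcons (f x) (h x) := by
  obtain ⟨p, hp⟩ := hf.polyLen
  obtain ⟨q, hq⟩ := hh.polyLen
  refine hf.foldr (step := fun b z => true :: b :: z) ((cons false).comp hh)
    (fun b => (cons true).comp (cons b)) ⟨2 * p + 1 + q, fun x l hl => ?_⟩
  change (DeltaStab.lcons l (h x)).length ≤ _
  have hlp := hl.length_le.trans (hp x)
  have hhq := hq x
  simp only [length_lcons, Polynomial.eval_add, Polynomial.eval_mul, Polynomial.eval_ofNat,
    Polynomial.eval_one, enc_list] at hhq ⊢
  omega

@[fun_prop]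
theorem dropBit : FP g fun z => dropBit z := by
  unfold DeltaStab.dropBit
  fun_prop

@[fun_prop]
theorem rotateBit : FP g fun z => rotateBit z := by
  have hbit : FP g fun z : List Bool => [z.tail.headD false] :=
    (headD.comp tail).recode fun _ => rfl
  unfold DeltaStab.rotateBit
  fun_prop

@[fun_prop]
theorem ltail : FP g fun z => ltail z := tail.comp (id.iterate id dropBit 0 length_dropBit_le)

@[fun_prop]
theorem lhead : FP g fun z => lhead z :=
  ((cons false).comp ltail).iterate (id.iterate id rotateBit 0 length_rotateBit_le) tail 0
    fun z => by rw [enc_list, List.length_tail]; exact Nat.sub_le _ _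

@[fun_prop]
theorem prodMk {f : α → β} {h : α → γ} (hf : FP g f) (hh : FP g h) : FP g fun x => (f x, h x) :=
  ((enc.comp hf).lcons (enc.comp hh)).recode fun _ => rfl

@[fun_prop]
theorem fst : FP g fun x : α × β => x.1 := (lhead.comp enc).recode fun p => by simp [enc_prod]

@[fun_prop]
theorem snd : FP g fun x : α × β => x.2 := (ltail.comp enc).recode fun p => by simp [enc_prod]

@[fun_prop]
theorem and {f h : α → Bool} (hf : FP g f) (hh : FP g h) : FP g fun x => f x && h x :=
  (hf.cond hh (const false)).recode fun x => by cases f x <;> rfl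

@[fun_prop]
theorem or {f h : α → Bool} (hf : FP g f) (hh : FP g h) : FP g fun x => f x || h x :=
  (hf.cond (const true) hh).recode fun x => by cases f x <;> rfl

@[fun_prop]
theorem not {f : α → Bool} (hf : FP g f) : FP g fun x => !f x :=
  (hf.cond (const false) (const true)).recode fun x => by cases f x <;> rfl

@[fun_prop]
theorem xor {f h : α → Bool} (hf : FP g f) (hh : FP g h) : FP g fun x => f x ^^ h x :=
  (hf.cond hh.not hh).recode fun x => by cases f x <;> simp

@[fun_prop]
theorem listCons {f : α → Bool} {h : α → List Bool} (hf : FP g f) (hh : FP g h) :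
    FP g fun x => f x :: h x := ((enc.comp hf).append hh).recode fun _ => rfl

theorem foldrWith {u : α → List Bool} {f : α → β} {step : α → Bool → β → β} (hu : FP g u)
    (hf : FP g f) (hstep : ∀ b, FP g fun p : α × β => step p.1 b p.2)
    (hlen : ∃ p : Polynomial ℕ, ∀ x l, l <:+ u x →
      (Enc.enc (l.foldr (step x) (f x))).length ≤ p.eval (Enc.enc x).length) :
    FP g fun x => (u x).foldr (step x) (f x) := by
  have hfold (x : α) (l : List Bool) :
      l.foldr (fun b p => (p.1, step p.1 b p.2)) (x, f x) = (x, l.foldr (step x) (f x)) := by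
    induction l with
    | nil => rfl
    | cons b l ih => rw [List.foldr_cons, ih, List.foldr_cons]
  obtain ⟨p, hp⟩ := hlen
  refine (snd.comp (hu.foldr (id.prodMk hf) (step := fun b p => (p.1, step p.1 b p.2))
    (fun b => fst.prodMk (hstep b)) ⟨2 * .X + 1 + p, fun x l hl => ?_⟩)).recode fun x => by
      rw [hfold]
  have hpl := hp x l hl
  simp only [hfold, length_enc_prod, Polynomial.eval_add, Polynomial.eval_mul, Polynomial.eval_X,
    Polynomial.eval_ofNat, Polynomial.eval_one]
  omega

theorem primrec {u : α → List Bool} {f : α → β} {step : α → List Bool → β → β} (hu : FP g u)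
    (hf : FP g f) (hstep : FP g fun p : α × List Bool × β => step p.1 p.2.1 p.2.2)
    (hlen : ∃ p : Polynomial ℕ, ∀ x, ∀ j ≤ (u x).length,
      (Enc.enc (j.rec (f x) fun i => step x (unary i) : β)).length ≤
        p.eval (Enc.enc x).length) :
    FP g fun x => ((u x).length.rec (f x) fun i => step x (unary i) : β) := by
  have hfold (x : α) (l : List Bool) :
      l.foldr (fun _ s => (true :: s.1, step x s.1 s.2)) (([], f x) : List Bool × β) =
        (unary l.length, l.length.rec (f x) fun i => step x (unary i)) := by
    induction l with
    | nil => rfl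
    | cons b l ih =>
      rw [List.foldr_cons, ih]
      rfl
  obtain ⟨p, hp⟩ := hlen
  obtain ⟨q, hq⟩ := hu.polyLen
  refine (snd.comp (hu.foldrWith (β := List Bool × β) (nil.prodMk hf)
    (step := fun x _ s => (true :: s.1, step x s.1 s.2))
    (fun _ => ((cons true).comp (fst.comp snd)).prodMk hstep)
    ⟨2 * q + 1 + p, fun x l hl => ?_⟩)).recode fun x => by rw [hfold]
  have hpl := hp x _ hl.length_le
  have hql := hl.length_le.trans (hq x)
  simp only [hfold, length_enc_prod, Polynomial.eval_add, Polynomial.eval_mul,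
    Polynomial.eval_ofNat, Polynomial.eval_one, enc_list, length_unary]
  omega

theorem unaryMul {a b : α → ℕ} (ha : FP g fun x => unary (a x)) (hb : FP g fun x => unary (b x)) :
    FP g fun x => unary (a x * b x) := by
  have hrec (x : α) (j : ℕ) :
      (j.rec [] fun _ y => unary (b x) ++ y : List Bool) = unary (j * b x) := by
    induction j with
    | zero => rw [zero_mul]; rfl
    | succ j ih =>
      rw [Nat.succ_mul, Nat.add_comm (j * b x), ← unary_append_unary, ← ih]
  obtain ⟨p, hp⟩ := ha.polyLen
  obtain ⟨q, hq⟩ := hb.polyLen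
  simp only [enc_list, length_unary] at hp hq
  refine (ha.primrec nil (step := fun x _ y => unary (b x) ++ y)
    ((hb.comp fst).append (snd.comp snd)) ⟨p * q, fun x j hj => ?_⟩).recode fun x => by
      rw [hrec, length_unary]
  rw [hrec, enc_list, length_unary, Polynomial.eval_mul]
  rw [length_unary] at hj
  exact Nat.mul_le_mul (hj.trans (hp x)) (hq x)

theorem unaryEval (p : Polynomial ℕ) : FP g fun x : List Bool => unary (p.eval x.length) := by
  have hlength : FP g fun x : List Bool => unary x.length := by
    have hiterate (k : ℕ) : (true :: ·)^[k] [] = unary k := by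
      induction k with
      | zero => rfl
      | succ k ih => rw [Function.iterate_succ_apply', ih]; rfl
    exact (id.iterate nil (cons true) 1 fun _ => le_rfl).recode fun x => by rw [hiterate]
  induction p using Polynomial.induction_on with
  | C c => simpa only [Polynomial.eval_C] using constString (unary c)
  | add p q hp hq =>
    exact (hp.append hq).recode fun x => by rw [Polynomial.eval_add, unary_append_unary]
  | monomial n c h =>
    refine (h.unaryMul hlength).recode fun x => ?_
    simp only [Polynomial.eval_mul, Polynomial.eval_C, Polynomial.eval_pow, Polynomial.eval_X,
      pow_succ, mul_assoc]

end FP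

/-! ### Binary arithmetic -/

instance : Enc ℕ := ⟨Nat.bits⟩

theorem enc_nat (n : ℕ) : enc n = n.bits := rfl

theorem length_enc_nat (n : ℕ) : (enc n).length = n.size := Nat.size_eq_bits_len n

theorem headD_bits (n : ℕ) : n.bits.headD false = n.bodd := by
  rw [Nat.bodd_eq_bits_head]
  cases n.bits <;> rfl

theorem size_div2_le (n : ℕ) : n.div2.size ≤ n.size :=
  Nat.size_le_size (Nat.div_le_self n 2)

theorem div2_lt_two_pow {n j : ℕ} (h : n < 2 ^ (j + 1)) : n.div2 < 2 ^ j := by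
  rw [Nat.div2_val]
  omega

theorem size_mul_le (a b : ℕ) : (a * b).size ≤ a.size + b.size := by
  rw [Nat.size_le, pow_add]
  exact Nat.mul_lt_mul'' (Nat.lt_size_self a) (Nat.lt_size_self b)

/-- The number with the given binary digits, the least significant digit first. -/
def ofBits (l : List Bool) : ℕ := l.foldr Nat.bit 0

theorem ofBits_bits (n : ℕ) : ofBits n.bits = n := by
  induction n using Nat.binaryRec' with
  | zero => rfl
  | bit b n h ih =>
    rw [Nat.bits_append_bit n b h]
    exact congrArg (Nat.bit b) ih

theorem ofBits_lt (l : List Bool) : ofBits l < 2 ^ l.length := by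
  induction l with
  | nil => exact one_pos
  | cons b l ih =>
    rw [List.length_cons, pow_succ]
    change Nat.bit b (ofBits l) < _
    cases b <;> simp only [Nat.bit_true, Nat.bit_false] <;> omega

namespace FP

@[fun_prop]
theorem bits : FP g fun n : ℕ => n.bits := enc

@[fun_prop]
theorem bodd : FP g fun n : ℕ => n.bodd := (headD.comp bits).recode fun n => by rw [headD_bits]

@[fun_prop]
theorem div2 : FP g fun n : ℕ => n.div2 :=
  (tail.comp bits).recode fun n => Nat.div2_bits_eq_tail n

@[fun_prop]
theorem bit {f : α → Bool} {h : α → ℕ} (hf : FP g f) (hh : FP g h) :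
    FP g fun x => Nat.bit (f x) (h x) := by
  have hbits : FP g fun x => (h x).bits := bits.comp hh
  refine ((hf.or (not (isEmpty.comp hbits))).cond (hf.listCons hbits) nil).recode fun x => ?_
  rw [enc_nat, enc_list]
  obtain hn | hn := eq_or_ne (h x) 0
  · cases hfx : f x <;> simp [hn]
  · rw [Nat.bits_append_bit _ _ fun h => absurd h hn]
    have hne : (h x).bits.isEmpty = false := by
      rw [List.isEmpty_eq_false_iff, ← List.length_pos_iff, Nat.size_eq_bits_len, Nat.size_pos]
      exact Nat.pos_of_ne_zero hn
    simp [hne]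

@[fun_prop]
theorem ofBits : FP g fun l => ofBits l := by
  refine id.foldr (const 0) (fun b => by fun_prop) ⟨.X, fun x l hl => ?_⟩
  rw [length_enc_nat, Polynomial.eval_X, Nat.size_le]
  exact (ofBits_lt l).trans_le (Nat.pow_le_pow_right two_pos hl.length_le)

theorem twoPow {u : α → List Bool} (hu : FP g u) : FP g fun x => 2 ^ (u x).length := by
  have hiterate (k : ℕ) : (Nat.bit false)^[k] 1 = 2 ^ k := by
    induction k with
    | zero => rfl
    | succ k ih => rw [Function.iterate_succ_apply', ih, Nat.bit_false, pow_succ']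
  refine (hu.iterate (const 1) (h := Nat.bit false) (by fun_prop) 1 fun n => ?_).recode
    fun x => by rw [hiterate]
  rw [length_enc_nat, length_enc_nat, Nat.size_le, Nat.bit_false, pow_succ']
  exact Nat.mul_lt_mul_of_pos_left (Nat.lt_size_self n) two_pos

theorem divTwoPow {u : α → List Bool} {f : α → ℕ} (hf : FP g f) (hu : FP g u) :
    FP g fun x => f x / 2 ^ (u x).length := by
  have hiterate (n k : ℕ) : Nat.div2^[k] n = n / 2 ^ k := by
    induction k with
    | zero => exact (Nat.div_one n).symm
    | succ k ih => rw [Function.iterate_succ_apply', ih, Nat.div2_val, Nat.div_div_eq_div_mul,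
        pow_succ]
  refine (hu.iterate hf div2 0 fun n => ?_).recode fun x => by rw [hiterate]
  rw [length_enc_nat, length_enc_nat]
  exact size_div2_le n

end FP

/-- One step of a digitwise operation on two numbers, the least significant digits first. The
state consists of the remaining parts of the numbers, the carry, which is updated by `κ`, and the
digits of the sum modulo `2` (with carry) produced so far, the most significant one first. -/
def ripple (κ : Bool → Bool → Bool → Bool) (s : ℕ × ℕ × Bool × List Bool) :
    ℕ × ℕ × Bool × List Bool :=
  (s.1.div2, s.2.1.div2, κ s.1.bodd s.2.1.bodd s.2.2.1,
    (s.1.bodd ^^ (s.2.1.bodd ^^ s.2.2.1)) :: s.2.2.2)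

/-- The carry of an addition. -/
def addCarry (a b c : Bool) : Bool := a && b || c && (a || b)

theorem foldl_iterate_ripple_addCarry {a b j : ℕ} (ha : a < 2 ^ j) (hb : b < 2 ^ j) (c : Bool)
    (l : List Bool) :
    ((ripple addCarry)^[j + 1] (a, b, c, l)).2.2.2.foldl (fun n b => Nat.bit b n) 0 =
      l.foldl (fun n b => Nat.bit b n) (a + b + c.toNat) := by
  induction j generalizing a b c l with
  | zero =>
    obtain rfl : a = 0 := by omega
    obtain rfl : b = 0 := by omega
    cases c <;> simp [ripple]
  | succ j ih =>
    rw [Function.iterate_succ_apply, ripple, ih (div2_lt_two_pow ha) (div2_lt_two_pow hb),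
      List.foldl_cons]
    congr 1
    have hdiv := Nat.bodd_add_div2 a
    have hdiv' := Nat.bodd_add_div2 b
    cases hx : a.bodd <;> cases hy : b.bodd <;> cases c <;>
      simp [hx, hy, addCarry, Nat.bit_val] at hdiv hdiv' ⊢ <;> omega

/-- The carry of a comparison: whether the digits up to the current one are in order. -/
def leCarry (a b c : Bool) : Bool := bif a ^^ b then b else c

theorem iterate_ripple_leCarry {a b j : ℕ} (ha : a < 2 ^ j) (hb : b < 2 ^ j) (c : Bool)
    (l : List Bool) :
    ((ripple leCarry)^[j] (a, b, c, l)).2.2.1 = decide (a < b + c.toNat) := by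
  induction j generalizing a b c l with
  | zero =>
    obtain rfl : a = 0 := by omega
    obtain rfl : b = 0 := by omega
    cases c <;> rfl
  | succ j ih =>
    rw [Function.iterate_succ_apply, ripple, ih (div2_lt_two_pow ha) (div2_lt_two_pow hb),
      decide_eq_decide]
    have hdiv := Nat.bodd_add_div2 a
    have hdiv' := Nat.bodd_add_div2 b
    cases hx : a.bodd <;> cases hy : b.bodd <;> cases c <;>
      simp [hx, hy, leCarry] at hdiv hdiv' ⊢ <;> omega

theorem lt_two_pow_length_bits_append (a b : ℕ) :
    a < 2 ^ (a.bits ++ b.bits).length ∧ b < 2 ^ (a.bits ++ b.bits).length := by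
  rw [List.length_append, Nat.size_eq_bits_len, Nat.size_eq_bits_len]
  exact ⟨(Nat.lt_size_self a).trans_le (Nat.pow_le_pow_right two_pos (Nat.le_add_right _ _)),
    (Nat.lt_size_self b).trans_le (Nat.pow_le_pow_right two_pos (Nat.le_add_left _ _))⟩

namespace FP

theorem iterate_ripple {κ : Bool → Bool → Bool → Bool} {u : α → List Bool}
    {f : α → ℕ × ℕ × Bool × List Bool}
    (hκ : FP g fun p : Bool × Bool × Bool => κ p.1 p.2.1 p.2.2) (hu : FP g u) (hf : FP g f) :
    FP g fun x => (ripple κ)^[(u x).length] (f x) := by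
  have hripple : FP g (ripple κ) := by
    have hcarry : FP g fun s : ℕ × ℕ × Bool × List Bool => κ s.1.bodd s.2.1.bodd s.2.2.1 :=
      hκ.comp (f := fun s : ℕ × ℕ × Bool × List Bool => (s.1.bodd, s.2.1.bodd, s.2.2.1))
        (by fun_prop)
    unfold ripple
    fun_prop
  refine hu.iterate hf hripple 1 fun s => ?_
  have h₁ := size_div2_le s.1
  have h₂ := size_div2_le s.2.1
  simp only [ripple, length_enc_prod, length_enc_nat, enc_list, enc_bool, List.length_cons]
  omega

@[fun_prop]
theorem add {f h : α → ℕ} (hf : FP g f) (hh : FP g h) : FP g fun x => f x + h x := by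
  have hsum : FP g fun x => ((ripple addCarry)^[(false :: ((f x).bits ++ (h x).bits)).length]
      (f x, h x, false, [])).2.2.2.reverse := by
    refine (reverse.comp (snd.comp (snd.comp snd))).comp (iterate_ripple ?_ ?_ ?_)
    · unfold addCarry
      fun_prop
    · fun_prop
    · fun_prop
  refine (ofBits.comp hsum).recode fun x => ?_
  obtain ⟨hlt, hlt'⟩ := lt_two_pow_length_bits_append (f x) (h x)
  rw [DeltaStab.ofBits, List.foldr_reverse, List.length_cons,
    foldl_iterate_ripple_addCarry hlt hlt']
  rfl

@[fun_prop]
theorem le {f h : α → ℕ} (hf : FP g f) (hh : FP g h) : FP g fun x => decide (f x ≤ h x) := by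
  have hcarry : FP g fun x => ((ripple leCarry)^[((f x).bits ++ (h x).bits).length]
      (f x, h x, true, [])).2.2.1 := by
    refine (fst.comp (snd.comp snd)).comp (iterate_ripple ?_ ?_ ?_)
    · unfold leCarry
      fun_prop
    · fun_prop
    · fun_prop
  refine hcarry.recode fun x => ?_
  obtain ⟨hlt, hlt'⟩ := lt_two_pow_length_bits_append (f x) (h x)
  rw [iterate_ripple_leCarry hlt hlt']
  simp only [Bool.toNat_true, Nat.lt_succ_iff]

@[fun_prop]
theorem mul {f h : α → ℕ} (hf : FP g f) (hh : FP g h) : FP g fun x => f x * h x := by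
  have hfold (m : ℕ) (l : List Bool) :
      l.foldr (fun b n => Nat.bit false n + bif b then m else 0) 0 = DeltaStab.ofBits l * m := by
    induction l with
    | nil => exact (Nat.zero_mul m).symm
    | cons b l ih =>
      rw [List.foldr_cons, ih]
      change _ = Nat.bit b (DeltaStab.ofBits l) * m
      cases b <;> simp only [Nat.bit_val, Bool.toNat_false, Bool.toNat_true, cond_true, cond_false]
        <;> ring
  obtain ⟨p, hp⟩ := hf.polyLen
  obtain ⟨q, hq⟩ := hh.polyLen
  refine ((bits.comp hf).foldrWith (const 0)
    (step := fun x b n => Nat.bit false n + bif b then h x else 0)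
    (fun b => by fun_prop) ⟨p + q, fun x l hl => ?_⟩).recode fun x => by
      rw [hfold, ofBits_bits]
  rw [hfold, length_enc_nat, Polynomial.eval_add]
  exact (size_mul_le _ _).trans (Nat.add_le_add
    ((Nat.size_le.mpr (ofBits_lt l)).trans (hl.length_le.trans (hp x)))
    ((length_enc_nat _).symm.trans_le (hq x)))

theorem exists_length_le {u : α → List Bool} {f : α → List Bool → β} (hu : FP g u)
    (hf : FP g fun p : α × List Bool => f p.1 p.2) :
    ∃ p : Polynomial ℕ, ∀ x, ∀ i < (u x).length,
      (Enc.enc (f x (unary i))).length ≤ p.eval (Enc.enc x).length := by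
  obtain ⟨p, hp⟩ := hf.polyLen
  obtain ⟨q, hq⟩ := hu.polyLen
  refine ⟨p.comp (2 * .X + 1 + q), fun x i hi => (hp (x, unary i)).trans ?_⟩
  have hi' := hi.le.trans (hq x)
  simp only [length_enc_prod, enc_list, length_unary, Polynomial.eval_comp, Polynomial.eval_add,
    Polynomial.eval_mul, Polynomial.eval_X, Polynomial.eval_ofNat, Polynomial.eval_one] at hi' ⊢
  exact eval_le_eval p (Nat.add_le_add_left hi' _)

theorem sumRange {u : α → List Bool} {f : α → List Bool → ℕ} (hu : FP g u)
    (hf : FP g fun p : α × List Bool => f p.1 p.2) :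
    FP g fun x => ∑ i ∈ Finset.range (u x).length, f x (unary i) := by
  have hrec (x : α) (j : ℕ) : (j.rec 0 fun i s => s + f x (unary i) : ℕ) =
      ∑ i ∈ Finset.range j, f x (unary i) := by
    induction j with
    | zero => rfl
    | succ j ih => rw [Finset.sum_range_succ, ← ih]
  obtain ⟨p, hp⟩ := exists_length_le hu hf
  obtain ⟨q, hq⟩ := hu.polyLen
  refine (hu.primrec (const 0) (step := fun x l s => s + f x l)
    ((snd.comp snd).add (hf.comp (fst.prodMk (fst.comp snd)))) ⟨q + p, fun x j hj => ?_⟩).recode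
    fun x => by rw [hrec]
  have hterm (i : ℕ) (hi : i ∈ Finset.range j) :
      f x (unary i) ≤ 2 ^ p.eval (Enc.enc x).length := by
    refine (Nat.size_le.mp ?_).le
    rw [← length_enc_nat]
    exact hp x i ((Finset.mem_range.mp hi).trans_le hj)
  rw [hrec, length_enc_nat, Nat.size_le, Polynomial.eval_add, pow_add]
  refine (Finset.sum_le_card_nsmul _ _ _ hterm).trans_lt ?_
  rw [Finset.card_range, smul_eq_mul]
  exact Nat.mul_lt_mul_of_pos_right (Nat.lt_two_pow_self.trans_le
    (Nat.pow_le_pow_right two_pos (hj.trans (hq x)))) (by positivity)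

theorem flatMapRange {u : α → List Bool} {f : α → List Bool → List Bool} (hu : FP g u)
    (hf : FP g fun p : α × List Bool => f p.1 p.2) :
    FP g fun x => (List.range (u x).length).flatMap fun i => f x (unary i) := by
  have hrec (x : α) (j : ℕ) : (j.rec [] fun i s => s ++ f x (unary i) : List Bool) =
      (List.range j).flatMap fun i => f x (unary i) := by
    induction j with
    | zero => rfl
    | succ j ih => simp [List.range_succ, ← ih]
  obtain ⟨p, hp⟩ := exists_length_le hu hf
  obtain ⟨q, hq⟩ := hu.polyLen
  refine (hu.primrec nil (step := fun x l s => s ++ f x l)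
    ((snd.comp snd).append (hf.comp (fst.prodMk (fst.comp snd)))) ⟨q * p, fun x j hj => ?_⟩).recode
    fun x => by rw [hrec]
  rw [hrec, enc_list, List.length_flatMap, Polynomial.eval_mul]
  refine (List.sum_le_card_nsmul _ (p.eval (Enc.enc x).length) fun k hk => ?_).trans ?_
  · obtain ⟨i, hi, rfl⟩ := List.mem_map.mp hk
    exact hp x i ((List.mem_range.mp hi).trans_le hj)
  · rw [List.length_map, List.length_range, smul_eq_mul]
    exact Nat.mul_le_mul_right _ (hj.trans (hq x))

theorem allRange {u : α → List Bool} {f : α → List Bool → Bool} (hu : FP g u)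
    (hf : FP g fun p : α × List Bool => f p.1 p.2) :
    FP g fun x => decide (∀ i < (u x).length, f x (unary i) = true) := by
  have hrec (x : α) (j : ℕ) : (j.rec true fun i s => s && f x (unary i) : Bool) =
      decide (∀ i < j, f x (unary i) = true) := by
    induction j with
    | zero => simp
    | succ j ih =>
      simp only [ih, Nat.forall_lt_succ_right, Bool.decide_and, Bool.decide_eq_true]
  exact (hu.primrec (const true) (step := fun x l s => s && f x l)
    ((snd.comp snd).and (hf.comp (fst.prodMk (fst.comp snd))))
    ⟨1, fun x j _ => by simp⟩).recode fun x => by rw [hrec]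

end FP

/-! ### Integers and predicates -/

/-- The integer-valued functions computable in polynomial time with oracle `g`, where an integer is
represented as a difference of two binary natural numbers. -/
@[fun_prop]
def FPInt (g : Oracle) (f : α → ℤ) : Prop :=
  ∃ p n : α → ℕ, FP g p ∧ FP g n ∧ ∀ x, f x = p x - n x

/-- The predicates decidable in polynomial time with oracle `g`. -/
@[fun_prop]
def FPPred (g : Oracle) (P : α → Prop) : Prop := ∃ u : α → Bool, FP g u ∧ ∀ x, u x = true ↔ P x

namespace FPInt

variable {f h : α → ℤ}

@[fun_prop]
theorem natCast {p : α → ℕ} (hp : FP g p) : FPInt g fun x => (p x : ℤ) :=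
  ⟨p, fun _ => 0, hp, .const 0, fun x => by simp⟩

@[fun_prop]
theorem intConst (c : ℤ) : FPInt g fun _ : α => c :=
  ⟨fun _ => c.toNat, fun _ => (-c).toNat, .const _, .const _, fun _ => c.toNat_sub_toNat_neg.symm⟩

@[fun_prop]
theorem neg (hf : FPInt g f) : FPInt g fun x => -f x := by
  obtain ⟨p, n, hp, hn, hf⟩ := hf
  exact ⟨n, p, hn, hp, fun x => by simp only [hf, neg_sub]⟩

@[fun_prop]
theorem add (hf : FPInt g f) (hh : FPInt g h) : FPInt g fun x => f x + h x := by
  obtain ⟨p, n, hp, hn, hf⟩ := hf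
  obtain ⟨q, k, hq, hk, hh⟩ := hh
  exact ⟨fun x => p x + q x, fun x => n x + k x, by fun_prop, by fun_prop, fun x => by
    simp only [hf, hh]; push_cast; ring⟩

@[fun_prop]
theorem sub (hf : FPInt g f) (hh : FPInt g h) : FPInt g fun x => f x - h x := by
  simpa only [sub_eq_add_neg] using hf.add hh.neg

theorem mul (hf : FPInt g f) (hh : FPInt g h) : FPInt g fun x => f x * h x := by
  obtain ⟨p, n, hp, hn, hf⟩ := hf
  obtain ⟨q, k, hq, hk, hh⟩ := hh
  exact ⟨fun x => p x * q x + n x * k x, fun x => p x * k x + n x * q x, by fun_prop, by fun_prop,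
    fun x => by simp only [hf, hh]; push_cast; ring⟩

@[fun_prop]
theorem sq (hf : FPInt g f) : FPInt g fun x => f x ^ 2 := by
  simpa only [pow_two] using hf.mul hf

@[fun_prop]
theorem cond {u : α → Bool} (hu : FP g u) (hf : FPInt g f) (hh : FPInt g h) :
    FPInt g fun x => bif u x then f x else h x := by
  obtain ⟨p, n, hp, hn, hf⟩ := hf
  obtain ⟨q, k, hq, hk, hh⟩ := hh
  refine ⟨fun x => bif u x then p x else q x, fun x => bif u x then n x else k x, by fun_prop,
    by fun_prop, fun x => ?_⟩
  cases hux : u x <;> simp only [hux, cond_true, cond_false, hf, hh]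

theorem sumRange {u : α → List Bool} {f : α → List Bool → ℤ} (hu : FP g u)
    (hf : FPInt g fun p : α × List Bool => f p.1 p.2) :
    FPInt g fun x => ∑ i ∈ Finset.range (u x).length, f x (unary i) := by
  obtain ⟨p, n, hp, hn, hf⟩ := hf
  refine ⟨_, _, .sumRange hu (f := fun x y => p (x, y)) hp,
    .sumRange hu (f := fun x y => n (x, y)) hn, fun x => ?_⟩
  push_cast
  rw [← Finset.sum_sub_distrib]
  exact Finset.sum_congr rfl fun i _ => hf (x, unary i)

end FPInt

namespace FPPred

variable {P Q : α → Prop}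

@[fun_prop]
theorem le {f h : α → ℤ} (hf : FPInt g f) (hh : FPInt g h) : FPPred g fun x => f x ≤ h x := by
  obtain ⟨p, n, hp, hn, hf⟩ := hf
  obtain ⟨q, k, hq, hk, hh⟩ := hh
  refine ⟨fun x => decide (p x + k x ≤ q x + n x), by fun_prop, fun x => ?_⟩
  simp only [hf, hh, decide_eq_true_eq]
  omega

@[fun_prop]
theorem lt {f h : α → ℤ} (hf : FPInt g f) (hh : FPInt g h) : FPPred g fun x => f x < h x := by
  simpa only [Int.lt_iff_add_one_le] using le (hf.add (.intConst 1)) hh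

@[fun_prop]
theorem and (hP : FPPred g P) (hQ : FPPred g Q) : FPPred g fun x => P x ∧ Q x := by
  obtain ⟨u, hu, hP⟩ := hP
  obtain ⟨v, hv, hQ⟩ := hQ
  exact ⟨fun x => u x && v x, by fun_prop, fun x => by rw [Bool.and_eq_true, hP, hQ]⟩

@[fun_prop]
theorem or (hP : FPPred g P) (hQ : FPPred g Q) : FPPred g fun x => P x ∨ Q x := by
  obtain ⟨u, hu, hP⟩ := hP
  obtain ⟨v, hv, hQ⟩ := hQ
  exact ⟨fun x => u x || v x, by fun_prop, fun x => by rw [Bool.or_eq_true, hP, hQ]⟩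

@[fun_prop]
theorem not (hP : FPPred g P) : FPPred g fun x => ¬ P x := by
  obtain ⟨u, hu, hP⟩ := hP
  exact ⟨fun x => !u x, by fun_prop, fun x => by
    rw [Bool.not_eq_true', ← Bool.not_eq_true, hP]⟩

@[fun_prop]
theorem eqTrue {u : α → Bool} (hu : FP g u) : FPPred g fun x => u x = true :=
  ⟨u, hu, fun _ => Iff.rfl⟩

theorem comp {P : β → Prop} {u : α → β} (hP : FPPred g P) (hu : FP g u) :
    FPPred g fun x => P (u x) := by
  obtain ⟨v, hv, hP⟩ := hP
  exact ⟨fun x => v (u x), hv.comp hu, fun x => hP (u x)⟩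

theorem allRange {u : α → List Bool} {P : α → List Bool → Prop} (hu : FP g u)
    (hP : FPPred g fun p : α × List Bool => P p.1 p.2) :
    FPPred g fun x => ∀ i < (u x).length, P x (unary i) := by
  obtain ⟨v, hv, hP⟩ := hP
  exact ⟨_, .allRange hu (f := fun x y => v (x, y)) hv, fun x => by
    simp only [decide_eq_true_eq, hP]⟩

end FPPred

/-- The `|u|`-th element of the list of strings coded by `y`. -/
def nthString (u y : List Bool) : List Bool := lhead (ltail^[u.length] y)

@[fun_prop]
theorem FP.nthString {u f : α → List Bool} (hu : FP g u) (hf : FP g f) :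
    FP g fun x => nthString (u x) (f x) :=
  .comp .lhead (hu.iterate hf (by fun_prop) 0 length_ltail_le)

theorem nthString_encodeList (l : List (List Bool)) (i : ℕ) (hi : i < l.length) :
    nthString (unary i) (encodeList l) = l[i] := by
  induction l generalizing i with
  | nil => simp at hi
  | cons s l ih =>
    cases i with
    | zero => simp [nthString]
    | succ i =>
      have := ih i (by simpa using hi)
      simpa [nthString, Function.iterate_succ_apply] using this

/-! ### Membership in the polynomial hierarchy -/

theorem mem_PTime_of_FPPred {P : List Bool → Prop} (hP : FPPred g P) :
    {x | P x} ∈ PTime g.ask := by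
  obtain ⟨u, ⟨M, p, hM⟩, hu⟩ := hP
  refine mem_PTime_of_exec M p (fun x => [u x]) (fun x => ?_) fun x => by simpa using hu x
  rw [Store.single_eq_ofList, Store.single_eq_ofList]
  exact hM x

/-- Membership in a set of strings, as an oracle. -/
def Oracle.ofSet (B : Set (List Bool)) : Oracle := ⟨charFn B, 1, fun x => by simp [charFn]⟩

@[fun_prop]
theorem FPPred.mem_ofSet {B : Set (List Bool)} {f : α → List Bool} (hf : FP (.ofSet B) f) :
    FPPred (.ofSet B) fun x => f x ∈ B := by
  simpa [Oracle.ofSet, charFn] using FPPred.eqTrue (FP.headD.comp (FP.ask.comp hf))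

theorem exists_mem_SigmaP_succ {a : List Bool → List Bool} {k : ℕ} {B : Set (List Bool)}
    (hB : B ∈ SigmaP a k) (p : Polynomial ℕ) {R : List Bool → List Bool → Prop}
    (hR : FPPred (.ofSet B) fun z : List Bool × List Bool => R z.1 z.2) :
    {x | ∃ y : List Bool, y.length ≤ p.eval x.length ∧ R x y} ∈ SigmaP a (k + 1) := by
  have hV : FPPred (.ofSet B) fun z => R (lhead z) (lhead (ltail z)) :=
    hR.comp (u := fun z : List Bool => (lhead z, lhead (ltail z))) (by fun_prop)
  refine ⟨B, hB, _, mem_PTime_of_FPPred hV, p, fun x => ?_⟩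
  simp

theorem exists_mem_SigmaP_one (p : Polynomial ℕ) {R : List Bool → List Bool → Prop}
    (hR : FPPred g fun z : List Bool × List Bool => R z.1 z.2) :
    {x | ∃ y : List Bool, y.length ≤ p.eval x.length ∧ R x y} ∈ SigmaP g.ask 1 := by
  have hB : FPPred g fun z => R (lhead z) (lhead (ltail z)) :=
    hR.comp (u := fun z : List Bool => (lhead z, lhead (ltail z))) (by fun_prop)
  have hmem := exists_mem_SigmaP_succ (k := 0) (mem_PTime_of_FPPred hB) p
    (R := fun x y => lcons x (lcons y []) ∈ {z | R (lhead z) (lhead (ltail z))}) (by fun_prop)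
  simpa using hmem

theorem SigmaP_subset_succ (a : List Bool → List Bool) (k : ℕ) : SigmaP a k ⊆ SigmaP a (k + 1) :=
  fun L hL => by
    simpa [List.length_eq_zero_iff] using
      exists_mem_SigmaP_succ hL 0 (R := fun x _ => x ∈ L) (by fun_prop)

theorem mem_SigmaP_succ_of_compl {a : List Bool → List Bool} {k : ℕ} {L : Set (List Bool)}
    (hL : Lᶜ ∈ SigmaP a k) : L ∈ SigmaP a (k + 1) := by
  simpa [List.length_eq_zero_iff] using
    exists_mem_SigmaP_succ hL 0 (R := fun x _ => ¬ x ∈ Lᶜ) (by fun_prop)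

/-! ### The verifier -/

/-- The integer with sign bit `b` and absolute value `v`. -/
def signed (b : Bool) (v : ℕ) : ℤ := bif b then -(v : ℤ) else v

theorem signed_natAbs (z : ℤ) : signed (decide (z < 0)) z.natAbs = z := by
  rcases lt_or_ge z 0 with hz | hz
  · simp [signed, hz, abs_of_neg]
  · simp [signed, hz.not_gt, abs_of_nonneg hz]

theorem encodeDyadic_signed (b : Bool) (v k : ℕ) :
    encodeDyadic (signed b v, k) =
      encodeList [[b && !v.bits.isEmpty], v.bits, unary k] := by
  cases b
  · have hv : ¬ (v : ℤ) < 0 := by omega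
    simp [encodeDyadic, signed, hv]
  · rcases v.eq_zero_or_pos with rfl | hv
    · simp [encodeDyadic, signed]
    · have hbits : v.bits.isEmpty = false := by
        rw [List.isEmpty_eq_false_iff, ← List.length_pos_iff, Nat.size_eq_bits_len, Nat.size_pos]
        exact hv
      simp [encodeDyadic, signed, hv, hbits]

/-- The integer `⌊2 ^ k * |r|⌋` with the sign of `r`, for the dyadic `r` coded by `s`. -/
def scaleDyadic (k : ℕ) (s : List Bool) : ℤ :=
  signed ((lhead s).headD false)
    (2 ^ k * ofBits (lhead (ltail s)) / 2 ^ (lhead (ltail (ltail s))).length)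

section Verifier

variable (g : Oracle) (m : Polynomial ℕ) (x y : List Bool)

/-- The number of binary digits of the flow computed for the input `x`. -/
def coarse : ℕ := 2 * x.length + 5

/-- The number of digits by which the arguments of the flow are given more precisely than its
values: a polynomial bound for the modulus `m` on the queries made for the input `x`. -/
def extra : ℕ := m.eval (5 * x.length + 65) + 4

/-- All integers of the verifier are multiples of the unit `2 ^ (-fine m x)`. -/
def fine : ℕ := coarse x + extra m x

/-- The tolerance `2 ^ (-|x| - 1)` in units `2 ^ (-fine m x)`. -/
def margin : ℕ := 2 ^ (extra m x + (x.length + 4))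

/-- The dimension, in unary, of the system of the instance `x`. -/
def dimString : List Bool := lhead (ltail x)

/-- The oracle's answer for the term with code `c` at the arguments `d` with precision `i`. -/
def answer (c d i : List Bool) : List Bool :=
  g.ask (encodeList [encodeList [lhead x, dimString x, c], d, i])

/-- The constant with code `c`, in units. -/
def approxConst (c : List Bool) : ℤ :=
  scaleDyadic (fine m x) (answer g x c [] (unary (fine m x)))

/-- The lower endpoint of the box in the direction `l`, in units. -/
def approxLo (l : List Bool) : ℤ := approxConst g m x (encodeList [unary 1, l])

/-- The upper endpoint of the box in the direction `l`, in units. -/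
def approxHi (l : List Bool) : ℤ := approxConst g m x (encodeList [unary 2, l])

/-- The quantifier bound `k`, in units. -/
def approxBound (k : Bound) : ℤ := approxConst g m x (encodeList [unary 3, unary k.ctorIdx])

/-- A certificate `y` lists the arguments `(t, x₀)` of the flow, given in units as signed binary
numbers; this is the argument with number `|l|`. -/
def argument (l : List Bool) : ℤ :=
  signed ((nthString l y).headD false) (ofBits (nthString l y).tail)

/-- The oracle's encoding of the arguments of the flow given by `y`. -/
def argumentsCode : List Bool :=
  (List.range (true :: dimString x).length).flatMap fun l =>
    encodeList [encodeDyadic (argument y (unary l), fine m x)]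

/-- The coordinate `l` of the flow at the arguments given by `y`, in units. -/
def approxFlow (l : List Bool) : ℤ :=
  scaleDyadic (fine m x)
    (answer g x (encodeList [unary 0, l]) (argumentsCode m x y) (unary (coarse x)))

/-- The initial point given by `y` is approximately in the box. -/
def StartInBox : Prop :=
  ∀ i < (dimString x).length,
    approxLo g m x (unary i) - 8 ≤ argument y (unary (i + 1)) ∧
    argument y (unary (i + 1)) ≤ approxHi g m x (unary i) + 8

/-- The value of the flow at the arguments given by `y` is approximately in the box. -/
def FlowInBox : Prop :=
  ∀ i < (dimString x).length,
    approxLo g m x (unary i) - 2 ^ (extra m x + 1) ≤ approxFlow g m x y (unary i) ∧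
    approxFlow g m x y (unary i) ≤ approxHi g m x (unary i) + 2 ^ (extra m x + 1)

/-- The squared norm, in squared units, of the initial point given by `y`. -/
def startSq : ℤ := ∑ i ∈ Finset.range (dimString x).length, argument y (unary (i + 1)) ^ 2

/-- The squared norm, in squared units, of the value of the flow at the arguments given by `y`. -/
def flowSq : ℤ := ∑ i ∈ Finset.range (dimString x).length, approxFlow g m x y (unary i) ^ 2

/-- The initial point given by `y` is approximately in the box and in the open ball of radius `δ`,
and the value of the flow is approximately outside the open ball of radius `ε`. -/
def Escapes (δ ε : Bound) : Prop :=
  StartInBox g m x y ∧ startSq x y < (approxBound g m x δ + margin m x) ^ 2 ∧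
    (approxBound g m x ε ≤ margin m x ∨
      (approxBound g m x ε - margin m x) ^ 2 ≤ flowSq g m x y)

/-- The certificate `y` refutes the bounded form of Lyapunov stability. -/
def RefutesStable : Prop :=
  (-8 ≤ argument y [] ∧ argument y [] ≤ approxBound g m x .T + 8) ∧ FlowInBox g m x y ∧
    Escapes g m x y .δlo .εlo

/-- The certificate `y` refutes the bounded form of convergence to the origin. -/
def RefutesAttractive : Prop :=
  (approxBound g m x .T' - approxBound g m x .δ''lo - 8 ≤ argument y [] ∧
    argument y [] ≤ approxBound g m x .T' + approxBound g m x .δ''lo + 8) ∧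
    Escapes g m x y .δ'lo .ε'lo

end Verifier

section

variable {m : Polynomial ℕ} {x y : α → List Bool} {f : α → List Bool}

@[fun_prop]
theorem FPInt.signed {b : α → Bool} {v : α → ℕ} (hb : FP g b) (hv : FP g v) :
    FPInt g fun x => signed (b x) (v x) := by
  unfold DeltaStab.signed
  fun_prop

theorem FP.encodeDyadic_signed {b : α → Bool} {v k : α → ℕ} (hb : FP g b) (hv : FP g v)
    (hk : FP g fun x => unary (k x)) : FP g fun x => encodeDyadic (signed (b x) (v x), k x) := by
  simp only [DeltaStab.encodeDyadic_signed, encodeList_cons, encodeList_nil]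
  fun_prop

theorem FP.two_pow_of_unary {k : α → ℕ} (hk : FP g fun x => unary (k x)) :
    FP g fun x => 2 ^ k x := by
  simpa only [length_unary] using hk.twoPow

theorem FPInt.scaleDyadic {k : α → ℕ} {s : α → List Bool} (hk : FP g fun x => unary (k x))
    (hs : FP g s) : FPInt g fun x => scaleDyadic (k x) (s x) := by
  have hpow := hk.two_pow_of_unary
  have hdiv : FP g fun x => 2 ^ k x * ofBits (lhead (DeltaStab.ltail (s x))) /
      2 ^ (DeltaStab.lhead (DeltaStab.ltail (DeltaStab.ltail (s x)))).length :=
    .divTwoPow (by fun_prop) (by fun_prop)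
  unfold DeltaStab.scaleDyadic
  fun_prop

theorem FP.unary_coarse : FP g fun x => unary (coarse x) :=
  (unaryEval (2 * .X + 5)).recode fun x => by simp [coarse]

theorem FP.unary_extra : FP g fun x => unary (extra m x) :=
  (unaryEval (m.comp (5 * .X + 65) + 4)).recode fun x => by simp [extra, Polynomial.eval_comp]

theorem FP.unary_fine : FP g fun x => unary (fine m x) := by
  simp only [fine, ← unary_append_unary]
  exact .append unary_coarse unary_extra

theorem FP.margin : FP g fun x => margin m x :=
  two_pow_of_unary ((unary_extra (m := m) |>.append (unaryEval (.X + 4))).recode fun x => by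
    rw [unary_append_unary]; simp)

@[fun_prop]
theorem FP.dimString : FP g fun x => dimString x := by
  unfold DeltaStab.dimString
  fun_prop

@[fun_prop]
theorem FP.answer {c d i : α → List Bool} (hx : FP g x) (hc : FP g c) (hd : FP g d) (hi : FP g i) :
    FP g fun z => answer g (x z) (c z) (d z) (i z) := by
  simp only [DeltaStab.answer, encodeList_cons, encodeList_nil]
  fun_prop

@[fun_prop]
theorem FPInt.approxConst {c : α → List Bool} (hx : FP g x) (hc : FP g c) :
    FPInt g fun z => approxConst g m (x z) (c z) :=
  .scaleDyadic (FP.unary_fine.comp hx) (.answer hx hc (.const []) (FP.unary_fine.comp hx))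

@[fun_prop]
theorem FPInt.approxLo {l : α → List Bool} (hx : FP g x) (hl : FP g l) :
    FPInt g fun z => approxLo g m (x z) (l z) := by
  simp only [DeltaStab.approxLo, encodeList_cons, encodeList_nil]
  fun_prop

@[fun_prop]
theorem FPInt.approxHi {l : α → List Bool} (hx : FP g x) (hl : FP g l) :
    FPInt g fun z => approxHi g m (x z) (l z) := by
  simp only [DeltaStab.approxHi, encodeList_cons, encodeList_nil]
  fun_prop

@[fun_prop]
theorem FPInt.approxBound (k : Bound) (hx : FP g x) :
    FPInt g fun z => approxBound g m (x z) k := by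
  unfold DeltaStab.approxBound
  fun_prop

@[fun_prop]
theorem FPInt.argument {l : α → List Bool} (hy : FP g y) (hl : FP g l) :
    FPInt g fun z => argument (y z) (l z) := by
  unfold DeltaStab.argument
  fun_prop

@[fun_prop]
theorem FP.argumentsCode (hx : FP g x) (hy : FP g y) :
    FP g fun z => argumentsCode m (x z) (y z) := by
  refine .flatMapRange (f := fun z l =>
    encodeList [encodeDyadic (DeltaStab.argument (y z) l, DeltaStab.fine m (x z))])
    (by fun_prop) ?_
  have hfine : FP g fun p : α × List Bool => unary (DeltaStab.fine m (x p.1)) :=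
    unary_fine.comp (by fun_prop)
  have hdyadic : FP g fun p : α × List Bool =>
      encodeDyadic (DeltaStab.argument (y p.1) p.2, DeltaStab.fine m (x p.1)) :=
    .encodeDyadic_signed (by fun_prop) (by fun_prop) hfine
  simp only [encodeList_cons, encodeList_nil]
  fun_prop

@[fun_prop]
theorem FPInt.approxFlow {l : α → List Bool} (hx : FP g x) (hy : FP g y) (hl : FP g l) :
    FPInt g fun z => approxFlow g m (x z) (y z) (l z) := by
  refine .scaleDyadic (FP.unary_fine.comp hx)
    (.answer hx ?_ (by fun_prop) (FP.unary_coarse.comp hx))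
  simp only [encodeList_cons, encodeList_nil]
  fun_prop

@[fun_prop]
theorem FPPred.startInBox (hx : FP g x) (hy : FP g y) :
    FPPred g fun z => StartInBox g m (x z) (y z) :=
  .allRange (P := fun z l =>
    DeltaStab.approxLo g m (x z) l - 8 ≤ DeltaStab.argument (y z) (true :: l) ∧
    DeltaStab.argument (y z) (true :: l) ≤ DeltaStab.approxHi g m (x z) l + 8)
    (by fun_prop) (by fun_prop)

@[fun_prop]
theorem FPPred.flowInBox (hx : FP g x) (hy : FP g y) :
    FPPred g fun z => FlowInBox g m (x z) (y z) := by
  have htol : FP g fun p : α × List Bool => 2 ^ (DeltaStab.extra m (x p.1) + 1) := by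
    simp only [pow_succ]
    exact .mul (.two_pow_of_unary (FP.unary_extra.comp (by fun_prop))) (.const 2)
  have htol' : FPInt g fun p : α × List Bool => (2 : ℤ) ^ (DeltaStab.extra m (x p.1) + 1) := by
    exact_mod_cast FPInt.natCast htol
  exact .allRange (P := fun z l =>
    DeltaStab.approxLo g m (x z) l - 2 ^ (DeltaStab.extra m (x z) + 1) ≤
      DeltaStab.approxFlow g m (x z) (y z) l ∧
    DeltaStab.approxFlow g m (x z) (y z) l ≤
      DeltaStab.approxHi g m (x z) l + 2 ^ (DeltaStab.extra m (x z) + 1))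
    (by fun_prop) (by fun_prop)

@[fun_prop]
theorem FPInt.startSq (hx : FP g x) (hy : FP g y) : FPInt g fun z => startSq (x z) (y z) :=
  .sumRange (f := fun z l => DeltaStab.argument (y z) (true :: l) ^ 2) (by fun_prop) (by fun_prop)

@[fun_prop]
theorem FPInt.flowSq (hx : FP g x) (hy : FP g y) : FPInt g fun z => flowSq g m (x z) (y z) :=
  .sumRange (f := fun z l => DeltaStab.approxFlow g m (x z) (y z) l ^ 2) (by fun_prop)
    (by fun_prop)

@[fun_prop]
theorem FPPred.escapes (δ ε : Bound) (hx : FP g x) (hy : FP g y) :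
    FPPred g fun z => Escapes g m (x z) (y z) δ ε := by
  have hmargin : FP g fun z => DeltaStab.margin m (x z) := FP.margin.comp hx
  unfold Escapes
  fun_prop

@[fun_prop]
theorem FPPred.refutesStable (hx : FP g x) (hy : FP g y) :
    FPPred g fun z => RefutesStable g m (x z) (y z) := by
  unfold RefutesStable
  fun_prop

@[fun_prop]
theorem FPPred.refutesAttractive (hx : FP g x) (hy : FP g y) :
    FPPred g fun z => RefutesAttractive g m (x z) (y z) := by
  unfold RefutesAttractive
  fun_prop

end

end

/-! ### The stability formula -/

namespace Formula

variable {V : Type}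

/-- The perturbation of a formula by the same constant at all atoms. -/
def strengthen (c : ℝ) : Formula V → Formula V
  | gt t => gt fun a => t a - c
  | ge t => ge fun a => t a - c
  | and φ ψ => and (φ.strengthen c) (ψ.strengthen c)
  | or φ ψ => or (φ.strengthen c) (ψ.strengthen c)
  | all x u v φ => all x u v (φ.strengthen c)
  | ex x u v φ => ex x u v (φ.strengthen c)

theorem isPerturbation_strengthen {δ c : ℝ} (hc : |c| ≤ δ) (φ : Formula V) :
    IsPerturbation δ φ (φ.strengthen c) := by
  induction φ with
  | gt t => exact .gt t c hc
  | ge t => exact .ge t c hc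
  | and φ ψ hφ hψ => exact .and hφ hψ
  | or φ ψ hφ hψ => exact .or hφ hψ
  | all x u v φ hφ => exact .all x u v hφ
  | ex x u v φ hφ => exact .ex x u v hφ

theorem strengthen_zero (φ : Formula V) : φ.strengthen 0 = φ := by
  induction φ <;> simp_all [strengthen]

theorem strengthen_allBox {n : ℕ} (c : ℝ) (x : Fin n → V) (lo hi : Fin n → ℝ) (φ : Formula V) :
    (allBox x lo hi φ).strengthen c = allBox x lo hi (φ.strengthen c) := by
  unfold allBox
  induction List.finRange n with
  | nil => rfl
  | cons i l ih => simp only [List.foldr_cons, strengthen, ih]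

theorem extend_comp_self {ι : Type} (x : ι → V) (a : V → ℝ) :
    Function.extend x (a ∘ x) a = a := by
  classical
  funext z
  by_cases hz : ∃ j, x j = z
  · rw [Function.extend_def, dif_pos hz, Function.comp_apply, hz.choose_spec]
  · rw [Function.extend_apply' _ _ _ hz]

theorem extend_update [DecidableEq V] {ι : Type} {x : ι → V} (hx : x.Injective) (v : ι → ℝ)
    (a : V → ℝ) (i : ι) (r : ℝ) :
    Function.extend x v (Function.update a (x i) r) = Function.extend x v a := by
  funext z
  by_cases hz : ∃ j, x j = z
  · obtain ⟨j, rfl⟩ := hz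
    simp only [hx.extend_apply]
  · have hne : z ≠ x i := fun h => hz ⟨i, h.symm⟩
    simp only [Function.extend_apply' _ _ _ hz, Function.update_of_ne hne]

theorem holds_allBox [DecidableEq V] {n : ℕ} {x : Fin n → V} (hx : x.Injective) (lo hi : Fin n → ℝ)
    (φ : Formula V) (a : V → ℝ) :
    (allBox x lo hi φ).Holds a ↔ ∀ v ∈ Set.Icc lo hi, φ.Holds (Function.extend x v a) := by
  suffices ∀ l : List (Fin n), l.Nodup → ∀ a : V → ℝ,
      (l.foldr (fun i ψ => all (x i) (fun _ => lo i) (fun _ => hi i) ψ) φ).Holds a ↔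
        ∀ v : Fin n → ℝ, (∀ i ∈ l, lo i ≤ v i ∧ v i ≤ hi i) → (∀ i ∉ l, v i = a (x i)) →
          φ.Holds (Function.extend x v a) by
    simpa [allBox, Pi.le_def, forall_and] using this _ (List.nodup_finRange n) a
  intro l hl
  induction l with
  | nil =>
    refine fun a => ⟨fun h v _ hv => ?_, fun h => ?_⟩
    · obtain rfl : v = a ∘ x := funext fun i => hv i List.not_mem_nil
      rwa [extend_comp_self]
    · have hφ := h (a ∘ x) (by simp) fun _ _ => rfl
      rwa [extend_comp_self] at hφ
  | cons i l ih =>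
    intro a
    rw [List.nodup_cons] at hl
    simp only [List.foldr_cons, Holds, ih hl.2, extend_update hx]
    constructor
    · intro h v hv hva
      refine h (v i) (hv i List.mem_cons_self) v (fun j hj => hv j (List.mem_cons_of_mem i hj))
        fun j hj => ?_
      rcases eq_or_ne j i with rfl | hji
      · rw [Function.update_self]
      · rw [Function.update_of_ne (hx.ne hji), hva j (List.not_mem_cons_of_ne_of_not_mem hji hj)]
    · intro h r hr v hv hva
      have hvi : v i = r := by rw [hva i hl.1, Function.update_self]
      refine h v (List.forall_mem_cons.mpr ⟨hvi ▸ hr, hv⟩) fun j hj => ?_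
      have ⟨hji, hjl⟩ := List.ne_and_not_mem_of_not_mem_cons hj
      rw [hva j hjl, Function.update_of_ne (hx.ne hji)]

end Formula

namespace BoundedSystem

open Formula

variable (B : BoundedSystem)

/-- The flow on coordinate vectors. -/
def flowAt (t : ℝ) (v : Fin B.n → ℝ) : EuclideanSpace ℝ (Fin B.n) := flowMap B.f t (WithLp.toLp 2 v)

theorem flowAt_zero (v : Fin B.n → ℝ) : B.flowAt 0 v = WithLp.toLp 2 v := by
  simp [flowAt, flowMap]

theorem x₀_injective {n : ℕ} : Function.Injective (Var.x₀ : Fin n → Var n) :=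
  fun _ _ h => by injection h

theorem xₜ_injective {n : ℕ} : Function.Injective (Var.xₜ : Fin n → Var n) :=
  fun _ _ h => by injection h

theorem holds_strengthen_flow_imp (c : ℝ) (z : Var B.n) (hx₀ : ∀ i, Var.x₀ i ≠ z)
    (hxₜ : ∀ i, Var.xₜ i ≠ z) (φ : Formula (Var B.n)) (a : Var B.n → ℝ) :
    ((allBox .x₀ B.lo B.hi <| allBox .xₜ B.lo B.hi <|
      imp (and (.lt (fun a => ‖vec .x₀ a‖) fun a => a z) B.flow) φ).strengthen c).Holds a ↔
    ∀ v ∈ Set.Icc B.lo B.hi, ∀ w ∈ Set.Icc B.lo B.hi, ‖WithLp.toLp 2 v‖ < a z + c →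
      ‖WithLp.toLp 2 w - B.flowAt (a .t) v‖ ≤ c →
      (φ.strengthen c).Holds (Function.extend Var.xₜ w (Function.extend Var.x₀ v a)) := by
  simp only [imp, neg, lt, flow, vec, strengthen_allBox, strengthen, holds_allBox x₀_injective,
    holds_allBox xₜ_injective, Holds]
  refine forall₄_congr fun v _ w _ => ?_
  simp only [xₜ_injective.extend_apply, x₀_injective.extend_apply, Function.extend_apply', hx₀, hxₜ,
    reduceCtorEq, exists_false, not_false_eq_true, neg_sub, neg_neg, gt_iff_lt, ge_iff_le,
    sub_nonneg, sub_pos]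
  rw [or_assoc, ← not_lt, sub_lt_iff_lt_add', ← not_le, add_comm, ← imp_iff_not_or,
    or_iff_not_imp_left, not_lt]
  rfl

theorem holds_strengthen_lStable (c : ℝ) (a : Var B.n → ℝ) :
    (B.lStable.strengthen c).Holds a ↔ ∀ ε ∈ Set.Icc (B.b .εlo) (B.b .εhi),
      ∃ δ ∈ Set.Icc (B.b .δlo) ε, ∀ t ∈ Set.Icc 0 (B.b .T),
        ∀ v ∈ Set.Icc B.lo B.hi, ∀ w ∈ Set.Icc B.lo B.hi, ‖WithLp.toLp 2 v‖ < δ + c →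
          ‖WithLp.toLp 2 w - B.flowAt t v‖ ≤ c → ‖WithLp.toLp 2 w‖ < ε - c := by
  simp only [lStable, strengthen, Holds,  const, holds_strengthen_flow_imp, ne_eq, reduceCtorEq,
    not_false_eq_true, implies_true, Function.update_self, ← Set.mem_Icc]
  simp [strengthen, Holds, Formula.lt, vec, xₜ_injective.extend_apply, sub_right_comm _ _ c]

theorem holds_strengthen_attractive (c : ℝ) (a : Var B.n → ℝ) :
    (B.attractive.strengthen c).Holds a ↔ ∃ δ' ∈ Set.Icc (B.b .δ'lo) (B.b .δ'hi),
      ∀ t ∈ Set.Icc 0 (B.b .T'), ∀ v ∈ Set.Icc B.lo B.hi, ∀ w ∈ Set.Icc B.lo B.hi,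
        ‖WithLp.toLp 2 v‖ < δ' + c → ‖WithLp.toLp 2 w - B.flowAt t v‖ ≤ c →
          ∀ ε' ∈ Set.Icc (B.b .ε'lo) (B.b .ε'hi), ∃ δ'' ∈ Set.Icc (B.b .δ''lo) (B.b .δ''hi),
            ∀ s ∈ Set.Icc (B.b .T' - δ'') (B.b .T' + δ''), ‖B.flowAt s v‖ < ε' - c := by
  simp only [attractive, strengthen, Holds,  const, holds_strengthen_flow_imp, ne_eq, reduceCtorEq,
    not_false_eq_true, implies_true, Function.update_self, ← Set.mem_Icc]
  simp [limAtT', const, strengthen, Holds, Formula.lt, flowAt, vec, x₀_injective.extend_apply,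
    sub_right_comm _ _ c]

theorem aStable_isTrue
    (hstable : ∀ t ∈ Set.Icc 0 (B.b .T), ∀ v ∈ Set.Icc B.lo B.hi, ‖WithLp.toLp 2 v‖ < B.b .δlo →
      (B.flowAt t v).ofLp ∈ Set.Icc B.lo B.hi → ‖B.flowAt t v‖ < B.b .εlo)
    (hattractive : ∀ s ∈ Set.Icc (B.b .T' - B.b .δ''lo) (B.b .T' + B.b .δ''lo),
      ∀ v ∈ Set.Icc B.lo B.hi, ‖WithLp.toLp 2 v‖ < B.b .δ'lo → ‖B.flowAt s v‖ < B.b .ε'lo) :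
    B.aStable.IsTrue := by
  rw [Formula.IsTrue, ← strengthen_zero B.aStable]
  refine ⟨(B.holds_strengthen_lStable 0 _).mpr fun ε hε => ⟨B.b .δlo, ⟨le_rfl, B.δ_le.trans hε.1⟩,
    fun t ht v hv w hw hvδ hwv => ?_⟩, (B.holds_strengthen_attractive 0 _).mpr
    ⟨B.b .δ'lo, ⟨le_rfl, B.δ'_le⟩, fun t _ v hv w _ hvδ' _ ε' hε' =>
      ⟨B.b .δ''lo, ⟨le_rfl, B.δ''_le⟩, fun s hs => ?_⟩⟩⟩
  · rw [add_zero] at hvδ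
    have hflow : WithLp.toLp 2 w = B.flowAt t v := sub_eq_zero.mp (norm_le_zero_iff.mp hwv)
    rw [sub_zero, hflow]
    exact (hstable t ht v hv hvδ (hflow ▸ hw)).trans_le hε.1
  · rw [add_zero] at hvδ'
    rw [sub_zero]
    exact (hattractive s hs v hv hvδ').trans_le hε'.1

theorem not_strengthen_aStable_of_lStable {c t : ℝ} (ht : t ∈ Set.Icc 0 (B.b .T))
    {v w : Fin B.n → ℝ} (hv : v ∈ Set.Icc B.lo B.hi) (hw : w ∈ Set.Icc B.lo B.hi)
    (hvδ : ‖WithLp.toLp 2 v‖ < B.b .δlo + c) (hwv : ‖WithLp.toLp 2 w - B.flowAt t v‖ ≤ c)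
    (hwε : B.b .εlo - c ≤ ‖WithLp.toLp 2 w‖) : ¬ (B.aStable.strengthen c).IsTrue := by
  rintro ⟨hstable, -⟩
  obtain ⟨δ, hδ, hescape⟩ := (B.holds_strengthen_lStable c _).mp hstable _ ⟨le_rfl, B.ε_le⟩
  exact hwε.not_gt (hescape t ht v hv w hw (by linarith [hδ.1]) hwv)

theorem not_strengthen_aStable_of_attractive {c s : ℝ} (hc : 0 ≤ c)
    (hs : s ∈ Set.Icc (B.b .T' - B.b .δ''lo) (B.b .T' + B.b .δ''lo))
    {v : Fin B.n → ℝ} (hv : v ∈ Set.Icc B.lo B.hi) (hvδ' : ‖WithLp.toLp 2 v‖ < B.b .δ'lo + c)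
    (hvε' : B.b .ε'lo - c ≤ ‖B.flowAt s v‖) : ¬ (B.aStable.strengthen c).IsTrue := by
  rintro ⟨-, hattractive⟩
  obtain ⟨δ', hδ', hlim⟩ := (B.holds_strengthen_attractive c _).mp hattractive
  obtain ⟨δ'', hδ'', hescape⟩ := hlim 0 ⟨le_rfl, B.T'_pos.le⟩ v hv v hv (by linarith [hδ'.1])
    (by rwa [flowAt_zero, sub_self, norm_zero]) _ ⟨le_rfl, B.ε'_le⟩
  exact hvε'.not_gt (hescape s ⟨by linarith [hs.1, hδ''.1], by linarith [hs.2, hδ''.1]⟩)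

end BoundedSystem

/-! ### Correctness of the verifier -/

section Approximation

theorem abs_scaleDyadic_encodeDyadic_sub_le (k : ℕ) (r : ℤ × ℕ) :
    |(scaleDyadic k (encodeDyadic r) : ℝ) - 2 ^ k * dyadicVal r| ≤ 1 := by
  have htrunc (b : Bool) (v j : ℕ) :
      |(signed b (2 ^ k * v / 2 ^ j) : ℝ) - 2 ^ k * ((signed b v : ℝ) / 2 ^ j)| ≤ 1 := by
    have hle := Nat.floor_le (show 0 ≤ ((2 ^ k * v : ℕ) : ℝ) / (2 ^ j : ℕ) by positivity)
    have hlt := Nat.lt_floor_add_one (((2 ^ k * v : ℕ) : ℝ) / (2 ^ j : ℕ))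
    rw [Nat.floor_div_eq_div] at hle hlt
    push_cast at hle hlt
    rw [mul_div_assoc] at hle hlt
    cases b <;> simp only [signed, cond_false, cond_true, Int.cast_neg, Int.cast_natCast, neg_div,
      mul_neg] <;> rw [abs_le] <;> constructor <;> linarith
  have hcode : scaleDyadic k (encodeDyadic r) =
      signed (decide (r.1 < 0)) (2 ^ k * r.1.natAbs / 2 ^ r.2) := by
    simp only [scaleDyadic, encodeDyadic, encodeList_cons, lhead_lcons, ltail_lcons,
      List.headD_cons, ofBits_bits, length_unary]
  simpa only [hcode, signed_natAbs, dyadicVal] using htrunc (decide (r.1 < 0)) r.1.natAbs r.2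

theorem two_pow_mul_inv_two_pow (k : ℕ) : (2 : ℝ) ^ k * 2⁻¹ ^ k = 1 := by
  rw [← mul_pow, mul_inv_cancel₀ two_ne_zero, one_pow]

theorem abs_scaleDyadic_sub_le {k i : ℕ} {r : ℤ × ℕ} {s : ℝ} (hik : i ≤ k)
    (h : |dyadicVal r - s| < 2⁻¹ ^ i) :
    |(scaleDyadic k (encodeDyadic r) : ℝ) - 2 ^ k * s| ≤ 2 ^ (k - i) + 1 := by
  have hpow : (2 : ℝ) ^ k * 2⁻¹ ^ i = 2 ^ (k - i) := by
    rw [← Nat.sub_add_cancel hik, pow_add, mul_assoc, two_pow_mul_inv_two_pow, mul_one,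
      Nat.add_sub_cancel]
  have hscaled : |2 ^ k * dyadicVal r - 2 ^ k * s| ≤ 2 ^ (k - i) := by
    rw [← mul_sub, abs_mul, abs_of_pos (by positivity), ← hpow]
    gcongr
  linarith [abs_sub_le (scaleDyadic k (encodeDyadic r) : ℝ) (2 ^ k * dyadicVal r) (2 ^ k * s),
    abs_scaleDyadic_encodeDyadic_sub_le k r]

theorem abs_dyadicVal_sub_le {z : ℤ} {j k M : ℕ} {s : ℝ} (h : |(z : ℝ) - 2 ^ k * s| ≤ 2 ^ j)
    (hM : M + j ≤ k) : |dyadicVal (z, k) - s| ≤ 2⁻¹ ^ M := by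
  have hdiv : dyadicVal (z, k) - s = (z - 2 ^ k * s) / 2 ^ k := by
    rw [dyadicVal, sub_div, mul_div_cancel_left₀ _ (by positivity)]
  rw [hdiv, abs_div, abs_of_pos (show (0 : ℝ) < 2 ^ k by positivity), div_le_iff₀ (by positivity)]
  calc |(z : ℝ) - 2 ^ k * s| ≤ 2 ^ j := h
    _ = 2⁻¹ ^ M * 2 ^ (M + j) := by
        rw [pow_add, ← mul_assoc, mul_comm (2⁻¹ ^ M), two_pow_mul_inv_two_pow, one_mul]
    _ ≤ 2⁻¹ ^ M * 2 ^ k := by gcongr; norm_num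

theorem exists_mem_Icc_abs_sub_le {U a b e r : ℝ} (hU : 0 < U) (hab : a ≤ b) (hr : 0 ≤ r)
    (ha : U * a - r ≤ e) (hb : e ≤ U * b + r) : ∃ c ∈ Set.Icc a b, |e - U * c| ≤ r := by
  rcases lt_or_ge e (U * a) with hea | hae
  · exact ⟨a, Set.left_mem_Icc.mpr hab, abs_le.mpr ⟨by linarith, by linarith⟩⟩
  rcases lt_or_ge (U * b) e with hbe | heb
  · exact ⟨b, Set.right_mem_Icc.mpr hab, abs_le.mpr ⟨by linarith, by linarith⟩⟩
  · exact ⟨e / U, ⟨(le_div_iff₀' hU).mpr hae, (div_le_iff₀' hU).mpr heb⟩, by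
      rwa [mul_div_cancel₀ _ hU.ne', sub_self, abs_zero]⟩

variable {ι : Type*} [Fintype ι]

theorem norm_toLp_le {v : ι → ℝ} {b : ℝ} (h : ∀ i, |v i| ≤ b) :
    ‖WithLp.toLp 2 v‖ ≤ Fintype.card ι * b := by
  rw [EuclideanSpace.norm_eq, ← Finset.card_univ, ← nsmul_eq_mul]
  calc √(∑ i, ‖v i‖ ^ 2) ≤ ∑ i, ‖v i‖ :=
        (Real.sqrt_le_left (by positivity)).mpr
          (Finset.sum_sq_le_sq_sum_of_nonneg fun i _ => norm_nonneg _)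
    _ ≤ Finset.card Finset.univ • b := Finset.sum_le_card_nsmul _ _ _ fun i _ => h i

theorem cast_sum_sq (z : ι → ℤ) :
    ((∑ i, z i ^ 2 : ℤ) : ℝ) = ‖WithLp.toLp 2 fun i => (z i : ℝ)‖ ^ 2 := by
  simp [EuclideanSpace.norm_sq_eq]

theorem sum_sq_lt_sq_iff (z : ι → ℤ) {r : ℤ} (hr : 0 ≤ r) :
    ∑ i, z i ^ 2 < r ^ 2 ↔ ‖WithLp.toLp 2 fun i => (z i : ℝ)‖ < r := by
  rw [← Int.cast_lt (R := ℝ), cast_sum_sq, Int.cast_pow,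
    sq_lt_sq₀ (norm_nonneg _) (Int.cast_nonneg hr)]

theorem nonpos_or_sq_le_sum_sq_iff (z : ι → ℤ) (r : ℤ) :
    r ≤ 0 ∨ r ^ 2 ≤ ∑ i, z i ^ 2 ↔ (r : ℝ) ≤ ‖WithLp.toLp 2 fun i => (z i : ℝ)‖ := by
  rcases le_or_gt r 0 with hr | hr
  · exact iff_of_true (.inl hr) ((Int.cast_nonpos.mpr hr).trans (norm_nonneg _))
  · rw [or_iff_right hr.not_ge, ← not_lt, sum_sq_lt_sq_iff z hr.le, not_lt]

end Approximation

open BoundedSystem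

/-- The string `x` is an instance of the stability problem for the system `B`, and the oracle `g`
computes the terms of `B` with a modulus that is bounded in terms of `m` and `|x|`. -/
structure IsInstance (g : Oracle) (m : Polynomial ℕ) (x : List Bool) (B : BoundedSystem) :
    Prop where
  dimString_eq : dimString x = unary B.n
  dim_lt : B.n < x.length
  exists_answer : ∀ (τ : TermName B.n) (i : ℕ), ∀ z ∈ (B.term τ).dom,
    ∀ d : Fin (B.term τ).arity → ℤ × ℕ,
      (∀ l, |dyadicVal (d l) - z l| ≤ 2⁻¹ ^ m.eval (3 * x.length + 60 + i)) →
      ∃ r : ℤ × ℕ, answer g x τ.code (encodeList (List.ofFn fun l => encodeDyadic (d l)))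
          (unary i) = encodeDyadic r ∧
        |dyadicVal r - (B.term τ).toFun z| < 2⁻¹ ^ i

theorem BoundedSystem.TermName.length_code_le {n : ℕ} (τ : TermName n) :
    τ.code.length ≤ 2 * n + 28 := by
  have hbound (k : Bound) : k.ctorIdx ≤ 10 := by cases k <;> decide
  rcases τ with i | i | i | k
  case bound =>
    have := hbound k
    simp only [TermName.code, encodeList_cons, encodeList_nil, length_lcons, length_unary,
      List.length_nil]
    omega
  all_goals
    simp only [TermName.code, encodeList_cons, encodeList_nil, length_lcons, length_unary,
      List.length_nil]
    omega

theorem isInstance_encodeList {g : Oracle} {m : Polynomial ℕ} {w q : List Bool}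
    {B : BoundedSystem}
    (hrep : ∀ (τ : TermName B.n) (i : ℕ), ∀ z ∈ (B.term τ).dom,
      ∀ d : Fin (B.term τ).arity → ℤ × ℕ,
        (∀ l, |dyadicVal (d l) - z l| ≤
          (2 : ℝ)⁻¹ ^ m.eval ((encodeList [w, unary B.n, τ.code]).length + i)) →
        ∃ r : ℤ × ℕ, g.ask (encodeList [encodeList [w, unary B.n, τ.code],
            encodeList (List.ofFn fun l => encodeDyadic (d l)), unary i]) = encodeDyadic r ∧
          |dyadicVal r - (B.term τ).toFun z| < (2 : ℝ)⁻¹ ^ i) :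
    IsInstance g m (encodeList [w, unary B.n, q]) B where
  dimString_eq := by simp [dimString]
  dim_lt := by
    simp only [encodeList_cons, encodeList_nil, length_lcons, length_unary, List.length_nil]
    omega
  exists_answer τ i z hz d hd := by
    have hans (c d i : List Bool) : answer g (encodeList [w, unary B.n, q]) c d i =
        g.ask (encodeList [encodeList [w, unary B.n, c], d, i]) := by
      simp [answer, dimString]
    rw [hans]
    refine hrep τ i z hz d fun l => (hd l).trans
      (pow_le_pow_of_le_one (by norm_num) (by norm_num) (eval_le_eval m ?_))
    have := τ.length_code_le
    simp only [encodeList_cons, encodeList_nil, length_lcons, length_unary, List.length_nil]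
    omega

namespace IsInstance

variable {g : Oracle} {m : Polynomial ℕ} {x y : List Bool} {B : BoundedSystem}

theorem length_dimString (hx : IsInstance g m x B) : (dimString x).length = B.n := by
  rw [hx.dimString_eq, length_unary]

theorem abs_approxConst_sub_le (hx : IsInstance g m x B) (τ : TermName B.n) {c : ℝ}
    (hτ : B.term τ = ⟨0, Set.univ, fun _ => c⟩) :
    |(approxConst g m x τ.code : ℝ) - 2 ^ fine m x * c| ≤ 2 := by
  have hans := hx.exists_answer τ (fine m x)
  rw [hτ] at hans
  obtain ⟨r, hr, hrc⟩ := hans Fin.elim0 trivial Fin.elim0 (fun l => l.elim0)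
  rw [List.ofFn_zero, encodeList_nil] at hr
  rw [approxConst, hr]
  exact (abs_scaleDyadic_sub_le le_rfl hrc).trans_eq (by norm_num)

theorem abs_approxLo_sub_le (hx : IsInstance g m x B) (i : Fin B.n) :
    |(approxLo g m x (unary i) : ℝ) - 2 ^ fine m x * B.lo i| ≤ 2 :=
  hx.abs_approxConst_sub_le (.lo i) rfl

theorem abs_approxHi_sub_le (hx : IsInstance g m x B) (i : Fin B.n) :
    |(approxHi g m x (unary i) : ℝ) - 2 ^ fine m x * B.hi i| ≤ 2 :=
  hx.abs_approxConst_sub_le (.hi i) rfl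

theorem abs_approxBound_sub_le (hx : IsInstance g m x B) (k : Bound) :
    |(approxBound g m x k : ℝ) - 2 ^ fine m x * B.b k| ≤ 2 :=
  hx.abs_approxConst_sub_le (.bound k) rfl

theorem argumentsCode_eq (hx : IsInstance g m x B) (y : List Bool) :
    argumentsCode m x y = encodeList (List.ofFn fun l : Fin (B.n + 1) =>
      encodeDyadic (argument y (unary l), fine m x)) := by
  rw [argumentsCode, List.length_cons, hx.length_dimString, List.ofFn_eq_map,
    ← List.map_coe_finRange_eq_range, List.flatMap_map, encodeList, List.flatMap_map]
  simp only [encodeList, List.flatMap_singleton]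

theorem abs_approxFlow_sub_le (hx : IsInstance g m x B) {t : ℝ} {v : Fin B.n → ℝ}
    (ht : t ∈ B.times) (hv : v ∈ Set.Icc B.lo B.hi)
    (ht' : |(argument y [] : ℝ) - 2 ^ fine m x * t| ≤ 16)
    (hv' : ∀ i : Fin B.n, |(argument y (unary (i + 1)) : ℝ) - 2 ^ fine m x * v i| ≤ 16)
    (i : Fin B.n) :
    |(approxFlow g m x y (unary i) : ℝ) - 2 ^ fine m x * B.flowAt t v i| ≤
      2 ^ extra m x + 1 := by
  have hcoarse : fine m x - coarse x = extra m x := by rw [fine, Nat.add_sub_cancel_left]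
  have hextra : m.eval (3 * x.length + 60 + coarse x) + 4 ≤ fine m x := by
    have := eval_le_eval m (show 3 * x.length + 60 + coarse x ≤ 5 * x.length + 65 by
      rw [coarse]; omega)
    rw [fine, extra]
    omega
  have hclose (l : Fin (B.n + 1)) :
      |(argument y (unary l) : ℝ) - 2 ^ fine m x * (Fin.cons t v : Fin (B.n + 1) → ℝ) l| ≤
        2 ^ 4 := by
    norm_num only
    cases l using Fin.cases with
    | zero => exact ht'
    | succ i => exact hv' i
  obtain ⟨r, hr, hrc⟩ := hx.exists_answer (.flow i) (coarse x) (Fin.cons t v)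
    ⟨ht, fun j => ⟨hv.1 j, hv.2 j⟩⟩ (fun l => (argument y (unary l), fine m x))
    fun l => abs_dyadicVal_sub_le (hclose l) hextra
  have hans : answer g x (encodeList [unary 0, unary i]) (argumentsCode m x y)
      (unary (coarse x)) = encodeDyadic r := by
    rw [hx.argumentsCode_eq]
    exact hr
  rw [approxFlow, hans, ← hcoarse]
  exact abs_scaleDyadic_sub_le (by rw [fine]; omega) hrc

end IsInstance

/-- The initial point given by `y`, in units. -/
def startPoint (y : List Bool) (n : ℕ) : EuclideanSpace ℝ (Fin n) :=
  WithLp.toLp 2 fun i => (argument y (unary (i + 1)) : ℝ)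

/-- The value of the flow at the arguments given by `y`, in units. -/
def flowPoint (g : Oracle) (m : Polynomial ℕ) (x y : List Bool) (n : ℕ) :
    EuclideanSpace ℝ (Fin n) :=
  WithLp.toLp 2 fun i => (approxFlow g m x y (unary i) : ℝ)

theorem two_pow_fine_mul (m : Polynomial ℕ) (x : List Bool) :
    (2 : ℝ) ^ fine m x * 2⁻¹ ^ x.length = 2 * margin m x := by
  have hfine : fine m x = 1 + (extra m x + (x.length + 4)) + x.length := by
    rw [fine, coarse]; omega
  rw [hfine, pow_add, mul_assoc, two_pow_mul_inv_two_pow, pow_add, margin]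
  push_cast
  ring

namespace IsInstance

variable {g : Oracle} {m : Polynomial ℕ} {x y : List Bool} {B : BoundedSystem}

theorem dim_mul_add_two_le_margin (hx : IsInstance g m x B) :
    B.n * (2 ^ (extra m x + 1) + 16) + 2 ≤ (margin m x : ℝ) := by
  have hdim : (B.n + 1 : ℝ) ≤ 2 ^ x.length := by
    exact_mod_cast hx.dim_lt.trans Nat.lt_two_pow_self
  have hextra : (16 : ℝ) ≤ 2 ^ extra m x := by
    rw [extra, pow_add]
    linarith [one_le_pow₀ (n := m.eval (5 * x.length + 65)) (one_le_two (α := ℝ))]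
  calc (B.n * (2 ^ (extra m x + 1) + 16) + 2 : ℝ)
      ≤ (B.n + 1) * (2 ^ extra m x * 16) := by
        rw [pow_succ]
        nlinarith [(Nat.cast_nonneg B.n : (0 : ℝ) ≤ B.n)]
    _ ≤ 2 ^ x.length * (2 ^ extra m x * 16) := by gcongr
    _ = margin m x := by rw [margin]; push_cast; ring

section Norm

variable {u v : Fin B.n → ℝ}

theorem norm_sub_smul_add_two_le (hx : IsInstance g m x B)
    (h : ∀ i, |u i - 2 ^ fine m x * v i| ≤ 2 ^ (extra m x + 1) + 16) :
    ‖WithLp.toLp 2 u - (2 : ℝ) ^ fine m x • WithLp.toLp 2 v‖ + 2 ≤ margin m x := by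
  have hnorm := norm_toLp_le (v := u - (2 : ℝ) ^ fine m x • v) h
  rw [Fintype.card_fin, WithLp.toLp_sub, WithLp.toLp_smul] at hnorm
  linarith [hx.dim_mul_add_two_le_margin]

theorem abs_norm_sub_add_two_le (hx : IsInstance g m x B)
    (h : ∀ i, |u i - 2 ^ fine m x * v i| ≤ 2 ^ (extra m x + 1) + 16) :
    |‖WithLp.toLp 2 u‖ - 2 ^ fine m x * ‖WithLp.toLp 2 v‖| + 2 ≤ margin m x := by
  have hnorm := abs_norm_sub_norm_le (WithLp.toLp 2 u) ((2 : ℝ) ^ fine m x • WithLp.toLp 2 v)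
  rw [norm_smul, Real.norm_of_nonneg (by positivity)] at hnorm
  linarith [hx.norm_sub_smul_add_two_le h]

end Norm

theorem exists_mem_box_close (hx : IsInstance g m x B) {z : ℕ → ℤ} {r : ℤ} (hr : 0 ≤ r)
    (hz : ∀ i < (dimString x).length,
      approxLo g m x (unary i) - r ≤ z i ∧ z i ≤ approxHi g m x (unary i) + r) :
    ∃ v ∈ Set.Icc B.lo B.hi, ∀ i : Fin B.n, |(z i : ℝ) - 2 ^ fine m x * v i| ≤ r + 2 := by
  have hr' : (0 : ℝ) ≤ r + 2 := by positivity
  have hcoord (i : Fin B.n) :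
      ∃ c ∈ Set.Icc (B.lo i) (B.hi i), |(z i : ℝ) - 2 ^ fine m x * c| ≤ r + 2 := by
    obtain ⟨hlo, hhi⟩ := hz i (by rw [hx.length_dimString]; exact i.2)
    have hlo' := abs_le.mp (hx.abs_approxLo_sub_le i)
    have hhi' := abs_le.mp (hx.abs_approxHi_sub_le i)
    rify at hlo hhi
    exact exists_mem_Icc_abs_sub_le (by positivity) (B.lo_le_hi i) hr' (by linarith) (by linarith)
  choose v hv hzv using hcoord
  exact ⟨v, ⟨fun i => (hv i).1, fun i => (hv i).2⟩, hzv⟩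

theorem approx_box_of_close (hx : IsInstance g m x B) {v : Fin B.n → ℝ}
    (hv : v ∈ Set.Icc B.lo B.hi) {z : ℕ → ℤ} {r : ℤ}
    (hz : ∀ i : Fin B.n, |(z i : ℝ) - 2 ^ fine m x * v i| + 2 ≤ r) :
    ∀ i < (dimString x).length,
      approxLo g m x (unary i) - r ≤ z i ∧ z i ≤ approxHi g m x (unary i) + r := by
  rw [hx.length_dimString]
  intro i hi
  have hlo' := abs_le.mp (hx.abs_approxLo_sub_le ⟨i, hi⟩)
  have hhi' := abs_le.mp (hx.abs_approxHi_sub_le ⟨i, hi⟩)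
  have hzi := abs_le.mp (le_sub_iff_add_le.mpr (hz ⟨i, hi⟩))
  have hlo : (2 : ℝ) ^ fine m x * B.lo ⟨i, hi⟩ ≤ 2 ^ fine m x * v ⟨i, hi⟩ := by
    gcongr
    exact hv.1 _
  have hhi : (2 : ℝ) ^ fine m x * v ⟨i, hi⟩ ≤ 2 ^ fine m x * B.hi ⟨i, hi⟩ := by
    gcongr
    exact hv.2 _
  rify
  constructor <;> linarith

theorem approxBound_add_margin_nonneg (hx : IsInstance g m x B) {k : Bound} (hk : 0 ≤ B.b k) :
    0 ≤ approxBound g m x k + margin m x := by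
  have hclose := (abs_le.mp (hx.abs_approxBound_sub_le k)).1
  have hbound : 0 ≤ 2 ^ fine m x * B.b k := by positivity
  have hmargin : 0 ≤ B.n * ((2 : ℝ) ^ (extra m x + 1) + 16) := by positivity
  rify
  linarith [hx.dim_mul_add_two_le_margin]

theorem escapes_iff (hx : IsInstance g m x B) {δ : Bound} (hδ : 0 ≤ B.b δ) (ε : Bound) :
    Escapes g m x y δ ε ↔ StartInBox g m x y ∧
      ‖startPoint y B.n‖ < approxBound g m x δ + margin m x ∧
      approxBound g m x ε - margin m x ≤ ‖flowPoint g m x y B.n‖ := by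
  rw [Escapes, startSq, flowSq, hx.length_dimString, Finset.sum_range, Finset.sum_range,
    sum_sq_lt_sq_iff _ (hx.approxBound_add_margin_nonneg hδ), ← sub_nonpos,
    nonpos_or_sq_le_sum_sq_iff]
  push_cast
  rfl

theorem exists_mem_box_of_escapes (hx : IsInstance g m x B) {δ ε : Bound} (hδ : 0 ≤ B.b δ)
    (h : Escapes g m x y δ ε) :
    ∃ v ∈ Set.Icc B.lo B.hi, ‖WithLp.toLp 2 v‖ < B.b δ + 2⁻¹ ^ x.length ∧
      (∀ i : Fin B.n, |(argument y (unary (i + 1)) : ℝ) - 2 ^ fine m x * v i| ≤ 16) ∧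
      ∀ w : Fin B.n → ℝ, (∀ i : Fin B.n, |(approxFlow g m x y (unary i) : ℝ) -
        2 ^ fine m x * w i| ≤ 2 ^ (extra m x + 1) + 16) →
          B.b ε - 2⁻¹ ^ x.length ≤ ‖WithLp.toLp 2 w‖ := by
  obtain ⟨hbox, hstart, hflow⟩ := (hx.escapes_iff hδ ε).mp h
  have hU : (0 : ℝ) < 2 ^ fine m x := by positivity
  have hpow := two_pow_fine_mul m x
  obtain ⟨v, hv, hvclose⟩ := hx.exists_mem_box_close (by norm_num) hbox
  have hvclose' (i : Fin B.n) := (hvclose i).trans (show ((8 : ℤ) : ℝ) + 2 ≤ 16 by norm_num)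
  refine ⟨v, hv, ?_, hvclose', fun w hw => ?_⟩
  · have hnorm := abs_le.mp (le_sub_iff_add_le.mpr (hx.abs_norm_sub_add_two_le fun i =>
      (hvclose' i).trans (le_add_of_nonneg_left (by positivity))))
    rw [← mul_lt_mul_iff_right₀ hU, mul_add, hpow]
    have := abs_le.mp (hx.abs_approxBound_sub_le δ)
    rw [startPoint] at hstart
    linarith
  · have hnorm := abs_le.mp (le_sub_iff_add_le.mpr (hx.abs_norm_sub_add_two_le hw))
    rw [← mul_le_mul_iff_right₀ hU, mul_sub, hpow]
    have := abs_le.mp (hx.abs_approxBound_sub_le ε)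
    rw [flowPoint] at hflow
    linarith

theorem escapes_of_close (hx : IsInstance g m x B) {δ ε : Bound} (hδ : 0 ≤ B.b δ)
    {v w : Fin B.n → ℝ} (hv : v ∈ Set.Icc B.lo B.hi)
    (hvδ : ‖WithLp.toLp 2 v‖ < B.b δ) (hwε : B.b ε ≤ ‖WithLp.toLp 2 w‖)
    (hvclose : ∀ i : Fin B.n, |(argument y (unary (i + 1)) : ℝ) - 2 ^ fine m x * v i| ≤ 1)
    (hwclose : ∀ i : Fin B.n, |(approxFlow g m x y (unary i) : ℝ) -
      2 ^ fine m x * w i| ≤ 2 ^ (extra m x + 1) + 16) :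
    Escapes g m x y δ ε := by
  have hU : (0 : ℝ) < 2 ^ fine m x := by positivity
  refine (hx.escapes_iff hδ ε).mpr ⟨hx.approx_box_of_close hv fun i => ?_, ?_, ?_⟩
  · push_cast
    linarith [hvclose i]
  · have hpos : (0 : ℝ) < 2 ^ (extra m x + 1) := by positivity
    have hnorm := abs_le.mp (le_sub_iff_add_le.mpr (hx.abs_norm_sub_add_two_le fun i =>
      (hvclose i).trans (by linarith)))
    have := abs_le.mp (hx.abs_approxBound_sub_le δ)
    have := mul_lt_mul_of_pos_left hvδ hU
    rw [startPoint]
    linarith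
  · have hnorm := abs_le.mp (le_sub_iff_add_le.mpr (hx.abs_norm_sub_add_two_le hwclose))
    have := abs_le.mp (hx.abs_approxBound_sub_le ε)
    have := mul_le_mul_of_nonneg_left hwε hU.le
    rw [flowPoint]
    linarith

end IsInstance

namespace IsInstance

variable {g : Oracle} {m : Polynomial ℕ} {x y : List Bool} {B : BoundedSystem}

theorem not_strengthen_of_refutesStable (hx : IsInstance g m x B)
    (h : RefutesStable g m x y) : ¬ (B.aStable.strengthen (2⁻¹ ^ x.length)).IsTrue := by
  obtain ⟨⟨ht₀, htT⟩, hbox, hescapes⟩ := h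
  have hU : (0 : ℝ) < 2 ^ fine m x := by positivity
  obtain ⟨v, hv, hvδ, hvclose, hflow⟩ := hx.exists_mem_box_of_escapes B.δ_nonneg hescapes
  obtain ⟨t, ht, htclose⟩ : ∃ t ∈ Set.Icc 0 (B.b .T), |argument y [] - 2 ^ fine m x * t| ≤ 10 := by
    have hT := abs_le.mp (hx.abs_approxBound_sub_le .T)
    rify at ht₀ htT
    exact exists_mem_Icc_abs_sub_le hU B.T_pos.le (by norm_num) (by linarith) (by linarith)
  obtain ⟨w, hw, hwclose⟩ := hx.exists_mem_box_close (by positivity) hbox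
  push_cast at hwclose
  refine B.not_strengthen_aStable_of_lStable ht hv hw hvδ ?_ (hflow w fun i =>
    (hwclose i).trans (by linarith))
  have hpos : (0 : ℝ) < 2 ^ extra m x := by positivity
  have hwnorm : ‖flowPoint g m x y B.n - (2 : ℝ) ^ fine m x • WithLp.toLp 2 w‖ + 2 ≤ margin m x :=
    hx.norm_sub_smul_add_two_le fun i => (hwclose i).trans (by linarith)
  have hFnorm : ‖flowPoint g m x y B.n - (2 : ℝ) ^ fine m x • B.flowAt t v‖ + 2 ≤ margin m x :=
    hx.norm_sub_smul_add_two_le fun i =>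
      (hx.abs_approxFlow_sub_le (.inl (.inl ht)) hv (htclose.trans (by norm_num)) hvclose i).trans
        (by rw [pow_succ]; linarith)
  rw [← mul_le_mul_iff_right₀ hU, two_pow_fine_mul, ← Real.norm_of_nonneg hU.le, ← norm_smul,
    smul_sub]
  rw [norm_sub_rev] at hwnorm
  linarith [norm_sub_le_norm_sub_add_norm_sub ((2 : ℝ) ^ fine m x • WithLp.toLp 2 w)
    (flowPoint g m x y B.n) ((2 : ℝ) ^ fine m x • B.flowAt t v)]

theorem not_strengthen_of_refutesAttractive (hx : IsInstance g m x B)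
    (h : RefutesAttractive g m x y) : ¬ (B.aStable.strengthen (2⁻¹ ^ x.length)).IsTrue := by
  obtain ⟨⟨hs₁, hs₂⟩, hescapes⟩ := h
  obtain ⟨v, hv, hvδ', hvclose, hflow⟩ := hx.exists_mem_box_of_escapes B.δ'_nonneg hescapes
  obtain ⟨s, hs, hsclose⟩ : ∃ s ∈ Set.Icc (B.b .T' - B.b .δ''lo) (B.b .T' + B.b .δ''lo),
      |argument y [] - 2 ^ fine m x * s| ≤ 12 := by
    have hT' := abs_le.mp (hx.abs_approxBound_sub_le .T')
    have hδ'' := abs_le.mp (hx.abs_approxBound_sub_le .δ''lo)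
    rify at hs₁ hs₂
    exact exists_mem_Icc_abs_sub_le (by positivity) (by linarith [B.δ''_nonneg]) (by norm_num)
      (by rw [mul_sub]; linarith) (by rw [mul_add]; linarith)
  have htimes : s ∈ B.times := .inr ⟨by linarith [hs.1, B.δ''_le], by linarith [hs.2, B.δ''_le]⟩
  have hpos : (0 : ℝ) < 2 ^ extra m x := by positivity
  exact B.not_strengthen_aStable_of_attractive (by positivity) hs hv hvδ'
    (hflow (B.flowAt s v) fun i =>
      (hx.abs_approxFlow_sub_le htimes hv (hsclose.trans (by norm_num)) hvclose i).trans
        (by rw [pow_succ]; linarith))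

section Complete

variable {t : ℝ} {v : Fin B.n → ℝ}

theorem abs_approxFlow_sub_le_of_close (hx : IsInstance g m x B) (ht : t ∈ B.times)
    (hv : v ∈ Set.Icc B.lo B.hi) (htclose : |(argument y [] : ℝ) - 2 ^ fine m x * t| ≤ 1)
    (hvclose : ∀ i : Fin B.n, |(argument y (unary (i + 1)) : ℝ) - 2 ^ fine m x * v i| ≤ 1)
    (i : Fin B.n) :
    |(approxFlow g m x y (unary i) : ℝ) - 2 ^ fine m x * B.flowAt t v i| + 2 ≤
      2 ^ (extra m x + 1) := by
  have hextra : (2 : ℝ) ^ 4 ≤ 2 ^ extra m x := by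
    gcongr
    · norm_num
    · exact Nat.le_add_left _ _
  have := hx.abs_approxFlow_sub_le ht hv (htclose.trans (by norm_num))
    (fun i => (hvclose i).trans (by norm_num)) i
  rw [pow_succ]
  linarith

theorem refutesStable_of_close (hx : IsInstance g m x B) (ht : t ∈ Set.Icc 0 (B.b .T))
    (hv : v ∈ Set.Icc B.lo B.hi) (hvδ : ‖WithLp.toLp 2 v‖ < B.b .δlo)
    (hbox : (B.flowAt t v).ofLp ∈ Set.Icc B.lo B.hi) (hε : B.b .εlo ≤ ‖B.flowAt t v‖)
    (htclose : |(argument y [] : ℝ) - 2 ^ fine m x * t| ≤ 1)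
    (hvclose : ∀ i : Fin B.n, |(argument y (unary (i + 1)) : ℝ) - 2 ^ fine m x * v i| ≤ 1) :
    RefutesStable g m x y := by
  have hflow := hx.abs_approxFlow_sub_le_of_close (.inl (.inl ht)) hv htclose hvclose
  have ht₀ := mul_le_mul_of_nonneg_left ht.1 (show (0 : ℝ) ≤ 2 ^ fine m x by positivity)
  have htT := mul_le_mul_of_nonneg_left ht.2 (show (0 : ℝ) ≤ 2 ^ fine m x by positivity)
  have hT := abs_le.mp (hx.abs_approxBound_sub_le .T)
  obtain ⟨hle, hge⟩ := abs_le.mp htclose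
  refine ⟨⟨?_, ?_⟩, hx.approx_box_of_close hbox fun i => (hflow i).trans_eq (by push_cast; rfl),
    hx.escapes_of_close (w := (B.flowAt t v).ofLp) B.δ_nonneg hv hvδ hε hvclose
      fun i => by linarith [hflow i]⟩ <;>
  · rify
    linarith

theorem refutesAttractive_of_close (hx : IsInstance g m x B)
    (ht : t ∈ Set.Icc (B.b .T' - B.b .δ''lo) (B.b .T' + B.b .δ''lo))
    (hv : v ∈ Set.Icc B.lo B.hi) (hvδ' : ‖WithLp.toLp 2 v‖ < B.b .δ'lo)
    (hε' : B.b .ε'lo ≤ ‖B.flowAt t v‖)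
    (htclose : |(argument y [] : ℝ) - 2 ^ fine m x * t| ≤ 1)
    (hvclose : ∀ i : Fin B.n, |(argument y (unary (i + 1)) : ℝ) - 2 ^ fine m x * v i| ≤ 1) :
    RefutesAttractive g m x y := by
  have htimes : t ∈ B.times := .inr ⟨by linarith [ht.1, B.δ''_le], by linarith [ht.2, B.δ''_le]⟩
  have hflow := hx.abs_approxFlow_sub_le_of_close htimes hv htclose hvclose
  have ht₁ := mul_le_mul_of_nonneg_left ht.1 (show (0 : ℝ) ≤ 2 ^ fine m x by positivity)
  have ht₂ := mul_le_mul_of_nonneg_left ht.2 (show (0 : ℝ) ≤ 2 ^ fine m x by positivity)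
  have hT' := abs_le.mp (hx.abs_approxBound_sub_le .T')
  have hδ'' := abs_le.mp (hx.abs_approxBound_sub_le .δ''lo)
  rw [mul_sub] at ht₁
  rw [mul_add] at ht₂
  obtain ⟨hle, hge⟩ := abs_le.mp htclose
  refine ⟨⟨?_, ?_⟩, hx.escapes_of_close (w := (B.flowAt t v).ofLp) B.δ'_nonneg hv hvδ' hε' hvclose
    fun i => by linarith [hflow i]⟩ <;>
  · rify
    linarith

end Complete

end IsInstance

theorem length_encodeList_le {l : List (List Bool)} {k : ℕ} (hl : ∀ s ∈ l, s.length ≤ k) :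
    (encodeList l).length ≤ l.length * (2 * k + 1) := by
  induction l with
  | nil => simp
  | cons s l ih =>
    obtain ⟨hs, hl⟩ := List.forall_mem_cons.mp hl
    rw [encodeList_cons, length_lcons, List.length_cons, add_one_mul]
    linarith [ih hl]

theorem exists_abs_argument_sub_le {n k : ℕ} {u : Fin n → ℝ} (hu : ∀ l, |u l| ≤ 2 ^ k) :
    ∃ y : List Bool, y.length ≤ n * (2 * (k + 3) + 1) ∧
      ∀ l : Fin n, |(argument y (unary l) : ℝ) - u l| ≤ 1 := by
  refine ⟨encodeList (List.ofFn fun l => decide (round (u l) < 0) :: (round (u l)).natAbs.bits),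
    ?_, fun l => ?_⟩
  · have hround (l : Fin n) : (round (u l)).natAbs < 2 ^ (k + 2) := by
      have hle : |(round (u l) : ℝ)| ≤ 2 ^ k + 1 := by
        linarith [abs_sub_abs_le_abs_sub (round (u l) : ℝ) (u l), hu l, abs_sub_round (u l),
          abs_sub_comm (u l) (round (u l))]
      have hone : (1 : ℝ) ≤ 2 ^ k := one_le_pow₀ one_le_two
      rify
      rw [pow_add]
      linarith
    refine (length_encodeList_le (k := k + 3) fun s hs => ?_).trans_eq (by rw [List.length_ofFn])
    obtain ⟨l, rfl⟩ := List.mem_ofFn.mp hs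
    rw [List.length_cons, Nat.size_eq_bits_len]
    exact Nat.succ_le_succ (Nat.size_le.mpr (hround l))
  · have hargument : argument (encodeList (List.ofFn fun l =>
        decide (round (u l) < 0) :: (round (u l)).natAbs.bits)) (unary l) = round (u l) := by
      rw [argument, nthString_encodeList _ _ (by simp)]
      simp only [List.getElem_ofFn, List.headD_cons, List.tail_cons, ofBits_bits, signed_natAbs]
    rw [hargument, abs_sub_comm]
    exact (abs_sub_round (u l)).trans (by norm_num)

theorem FPInt.exists_abs_le {α : Type} [Enc α] {g : Oracle} {f : α → ℤ} (hf : FPInt g f) :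
    ∃ r : Polynomial ℕ, ∀ x, |f x| ≤ 2 ^ r.eval (Enc.enc x).length := by
  obtain ⟨p, n, hp, hn, hpn⟩ := hf
  obtain ⟨rp, hrp⟩ := hp.polyLen
  obtain ⟨rn, hrn⟩ := hn.polyLen
  refine ⟨rp + rn, fun x => ?_⟩
  have hpx : p x < 2 ^ (rp + rn).eval (Enc.enc x).length :=
    Nat.size_le.mp ((length_enc_nat (p x)).symm.trans_le
      ((hrp x).trans (by rw [Polynomial.eval_add]; exact Nat.le_add_right _ _)))
  have hnx : n x < 2 ^ (rp + rn).eval (Enc.enc x).length :=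
    Nat.size_le.mp ((length_enc_nat (n x)).symm.trans_le
      ((hrn x).trans (by rw [Polynomial.eval_add]; exact Nat.le_add_left _ _)))
  zify at hpx hnx
  rw [hpn, abs_le]
  constructor <;> linarith [(p x).cast_nonneg (α := ℤ), (n x).cast_nonneg (α := ℤ)]

theorem exists_abs_approxConst_le (g : Oracle) (m : Polynomial ℕ) :
    ∃ r : Polynomial ℕ, ∀ {x : List Bool} {B : BoundedSystem}, IsInstance g m x B →
      ∀ τ : TermName B.n, |approxConst g m x τ.code| ≤ 2 ^ r.eval x.length := by
  have hconst : FPInt g fun z : List Bool × List Bool => approxConst g m z.1 z.2 := by fun_prop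
  obtain ⟨r, hr⟩ := hconst.exists_abs_le
  refine ⟨r.comp (6 * .X + 58), fun {x B} hx τ => (hr (x, τ.code)).trans
    (pow_le_pow_right₀ one_le_two ?_)⟩
  simp only [Polynomial.eval_comp, Polynomial.eval_add, Polynomial.eval_mul,
    Polynomial.eval_ofNat, Polynomial.eval_X]
  refine eval_le_eval r ?_
  have := τ.length_code_le
  have := hx.dim_lt
  simp only [length_enc_prod, enc_list]
  omega

theorem IsInstance.exists_certificate {g : Oracle} {m : Polynomial ℕ} {x : List Bool}
    {B : BoundedSystem} (hx : IsInstance g m x B) {A : ℕ}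
    (hA : ∀ τ : TermName B.n, |approxConst g m x τ.code| ≤ 2 ^ A) {t : ℝ}
    (ht : |t| ≤ B.b .T + B.b .T' + B.b .δ''lo) {v : Fin B.n → ℝ} (hv : v ∈ Set.Icc B.lo B.hi) :
    ∃ y : List Bool, y.length ≤ (x.length + 1) * (2 * (A + 7) + 1) ∧
      |(argument y [] : ℝ) - 2 ^ fine m x * t| ≤ 1 ∧
      ∀ i : Fin B.n, |(argument y (unary (i + 1)) : ℝ) - 2 ^ fine m x * v i| ≤ 1 := by
  have hU : (0 : ℝ) < 2 ^ fine m x := by positivity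
  have hone : (1 : ℝ) ≤ 2 ^ A := one_le_pow₀ one_le_two
  have hterm (τ : TermName B.n) {c : ℝ} (hτ : B.term τ = ⟨0, Set.univ, fun _ => c⟩) :
      |2 ^ fine m x * c| ≤ 3 * 2 ^ A := by
    have hclose := hx.abs_approxConst_sub_le τ hτ
    have hsize : |(approxConst g m x τ.code : ℝ)| ≤ 2 ^ A := by exact_mod_cast hA τ
    linarith [abs_sub_abs_le_abs_sub (2 ^ fine m x * c) (approxConst g m x τ.code : ℝ),
      abs_sub_comm (2 ^ fine m x * c) (approxConst g m x τ.code : ℝ)]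
  have hbound (k : Bound) : 2 ^ fine m x * B.b k ≤ 3 * 2 ^ A :=
    le_of_abs_le (hterm (.bound k) rfl)
  have htime : |2 ^ fine m x * t| ≤ 2 ^ (A + 4) := by
    rw [abs_mul, abs_of_pos hU, pow_add]
    have := mul_le_mul_of_nonneg_left ht hU.le
    linarith [hbound .T, hbound .T', hbound .δ''lo]
  have hstart (i : Fin B.n) : |2 ^ fine m x * v i| ≤ 2 ^ (A + 4) := by
    refine (abs_le_max_abs_abs (mul_le_mul_of_nonneg_left (hv.1 i) hU.le)
      (mul_le_mul_of_nonneg_left (hv.2 i) hU.le)).trans ((max_le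
        (hterm (.lo i) rfl) (hterm (.hi i) rfl)).trans ?_)
    rw [pow_add]
    linarith
  obtain ⟨y, hy, hclose⟩ := exists_abs_argument_sub_le (n := B.n + 1)
    (u := Fin.cons (2 ^ fine m x * t) fun i => 2 ^ fine m x * v i) (Fin.cases htime hstart)
  refine ⟨y, hy.trans ?_, hclose 0, fun i => hclose i.succ⟩
  gcongr
  exact hx.dim_lt.le

theorem IsInstance.aStable_isTrue_of_forall_not_refutes {g : Oracle} {m : Polynomial ℕ}
    {x : List Bool} {B : BoundedSystem} (hx : IsInstance g m x B) {A : ℕ}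
    (hA : ∀ τ : TermName B.n, |approxConst g m x τ.code| ≤ 2 ^ A)
    (hno : ∀ y : List Bool, y.length ≤ (x.length + 1) * (2 * (A + 7) + 1) →
      ¬ (RefutesStable g m x y ∨ RefutesAttractive g m x y)) : B.aStable.IsTrue := by
  have hT := B.T_pos
  have hT' := B.T'_pos
  have hδ'' := B.δ''_nonneg
  refine B.aStable_isTrue (fun t ht v hv hvδ hbox => ?_) (fun t ht v hv hvδ' => ?_)
  · by_contra! hε
    have hle : |t| ≤ B.b .T + B.b .T' + B.b .δ''lo :=
      abs_le.mpr ⟨by linarith [ht.1], by linarith [ht.2]⟩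
    obtain ⟨y, hy, htclose, hvclose⟩ := hx.exists_certificate hA hle hv
    exact hno y hy (.inl (hx.refutesStable_of_close ht hv hvδ hbox hε htclose hvclose))
  · by_contra! hε'
    have hle : |t| ≤ B.b .T + B.b .T' + B.b .δ''lo :=
      abs_le.mpr ⟨by linarith [ht.1], by linarith [ht.2]⟩
    obtain ⟨y, hy, htclose, hvclose⟩ := hx.exists_certificate hA hle hv
    exact hno y hy (.inr (hx.refutesAttractive_of_close ht hv hvδ' hε' htclose hvclose))

theorem inv_two_pow_length_instanceCode_le (S : Set (List Bool)) (sys : S → BoundedSystem) (w : S)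
    {δ : ℚ} (hδ : 0 < δ) : (2 : ℝ)⁻¹ ^ (instanceCode S sys w δ).length ≤ δ := by
  have hden : δ.den < 2 ^ (instanceCode S sys w δ).length := by
    refine Nat.size_le.mp ?_
    rw [instanceCode, ← Nat.size_eq_bits_len]
    simp only [encodeRat, encodeList_cons, encodeList_nil, length_lcons, List.length_nil]
    omega
  have hnum : (1 : ℝ) ≤ δ.num := by exact_mod_cast Rat.num_pos.mpr hδ
  have hden' : (δ.den : ℝ) ≤ 2 ^ (instanceCode S sys w δ).length := by exact_mod_cast hden.le
  rw [Rat.cast_def, inv_pow, ← one_div]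
  have := δ.den_pos
  gcongr

end DeltaStab

end

open DeltaStab in
theorem mainTheorem2_general (C : Set (List Bool → List Bool)) (S : Set (List Bool))
    (sys : S → BoundedSystem) (hterms : TermsInClass C S sys) :
    ∃ g ∈ C, ∃ L, Lᶜ ∈ SigmaP g 1 ∧ SolvesStability S sys L := by
  obtain ⟨θ, hθ, m, p, hlen, hrep⟩ := hterms
  let g : Oracle := ⟨θ, p, hlen⟩
  obtain ⟨r, hr⟩ := exists_abs_approxConst_le g m
  let q : Polynomial ℕ := (.X + 1) * (2 * (r + 7) + 1)
  let L : Set (List Bool) := {x | ∃ y : List Bool, y.length ≤ q.eval x.length ∧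
    (RefutesStable g m x y ∨ RefutesAttractive g m x y)}ᶜ
  have hL : Lᶜ ∈ SigmaP θ 1 := by
    rw [compl_compl]
    exact exists_mem_SigmaP_one (g := g) q (by fun_prop)
  refine ⟨θ, hθ, L, hL, fun w δ hδ => ?_⟩
  have hx : IsInstance g m (instanceCode S sys w δ) (sys w) :=
    isInstance_encodeList fun τ => hrep ⟨w, τ⟩
  constructor
  · intro hmem
    refine hx.aStable_isTrue_of_forall_not_refutes (hr hx) fun y hy h => hmem ⟨y, ?_, h⟩
    simpa [q] using hy
  · intro hmem
    obtain ⟨y, -, h⟩ := not_not.mp hmem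
    refine ⟨_, Formula.isPerturbation_strengthen ?_ _, h.elim hx.not_strengthen_of_refutesStable
      hx.not_strengthen_of_refutesAttractive⟩
    rw [abs_of_pos (by positivity)]
    exact inv_two_pow_length_instanceCode_le S sys w hδ

theorem mainTheorem2 (C : Set (List Bool → List Bool)) (S : Set (List Bool))
    (sys : S → DeltaStab.BoundedSystem) (hterms : DeltaStab.TermsInClass C S sys) :
    ∃ L ∈ DeltaStab.SigmaPClass C 4, DeltaStab.SolvesStability S sys L := by
  obtain ⟨g, hg, L, hL, hsolves⟩ := mainTheorem2_general C S sys hterms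
  exact ⟨L, ⟨g, hg, DeltaStab.SigmaP_subset_succ g 3 (DeltaStab.SigmaP_subset_succ g 2
    (DeltaStab.mem_SigmaP_succ_of_compl hL))⟩, hsolves⟩
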